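/- Let $n\ge 1$ and let $M$ be a closed smooth $(n-1)$-manifold. Write $\mathrm{Bun}(X)$ for the groupoid of principal $\mathbb Z/2$-bundles on a space $X$ and $\mathrm{Bun}(X,Y)$ for the groupoid of principal $\mathbb Z/2$-bundles $P\to X$ with a trivialization (section) $\xi$ over $Y\subset X$. **The toric code.** For a CW structure $\Xi$ on $M$ with $k$-skeleta $M^k_\Xi$ let $\mathcal H(\Xi)=\mathbb C[\mathrm{Bun}(M^1_\Xi,M^0_\Xi)]$ be the space of complex functions on isomorphism classes of objects. For a $0$-cell $v$ let $(A_v\psi)(P,\xi)=\psi(P,\xi+\delta_v)$; for a $2$-cell $f$ let $(B_f\psi)(P,\xi)=(-1)^{\mathrm{Hol}_P(f)}\psi(P,\xi)$, where $\mathrm{Hol}_P(f)\in\mathbb Z/2$ is the holonomy of $P$ around $\partial f$ ($0$ if the pullback of $P$ along the attaching map of $f$ is trivial, $1$ otherwise). The Hamiltonian is $H_\Xi=\sum_v\frac{1-A_v}{2}+\sum_f\frac{1-B_f}{2}$, and the space of ground states is $L(\Xi)=\ker H_\Xi$. A refinement $\varphi\colon\Xi\to\Xi'$ (every open cell of $\Xi$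 is a union of open cells of $\Xi'$ of at most the same dimension) induces by pullback of bundles a map $\varphi_*\colon\mathcal H(\Xi)\to\mathcal H(\Xi')$; let $\mathcal P$ be the projection of $\mathcal H(\Xi')$ that sets $\psi(P,\xi)$ to $0$ whenever $P$ has nontrivial holonomy around the boundary of some $2$-cell of $\Xi'$. A diffeomorphism $f$ of $M$ induces $f_*\colon\mathcal H(\Xi)\to\mathcal H(f(\Xi))$, $(f_*\psi)(P,\xi)=\psi(f^*P,f^*\xi)$, where $f(\Xi)$ has the characteristic maps of $\Xi$ composed with $f$. **Dijkgraaf–Witten theory.** The $\mathbb Z/2$-theory with zero Lagrangian has $\mathrm{DW}_0(N)=\mathbb C[\pi_0\mathrm{Bun}(N)]$, the space of complex functions on $\pi_0\mathrm{Bun}(N)$. To a bordism $W$ from $N$ to $N'$ with boundary inclusions $i,i'$ it assigns the push-pull map $(\mathrm{DW}_0(W)\Psi)(Q)=\sum_{[P]\in\pi_0\mathrm{Bun}(W),\ i'^*P\cong Q}\frac{|\mathrm{Aut}\,Q|}{|\mathrm{Aut}\,P|}\Psi(i^*P)$. The mapping cylinder $C_f$ of a diffeomorphism $f$ of $M$ is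 $[0,1]\times M$ with $\{0\}\times M$ (incoming) identified with $M$ by the identity and $\{1\}\times M$ (outgoing) identified with $M$ by $f$. Let $\mathrm{MCG}(M)=\mathrm{Diff}(M)/\mathrm{Diff}_0(M)$, where $\mathrm{Diff}_0(M)$ consists of the diffeomorphisms smoothly isotopic to the identity. **Theorem.** 1. $f\mapsto\mathrm{DW}_0(C_f)$ defines a linear representation of $\mathrm{MCG}(M)$ on $\mathrm{DW}_0(M)$, and it is the one induced from the standard action on $\pi_0\mathrm{Bun}(M)$: $(f\cdot\Psi)(Q)=\Psi(f^*Q)$. 2. For every CW structure $\Xi$ on $M$ there is an isomorphism of complex vector spaces $\Phi_\Xi\colon L(\Xi)\to\mathrm{DW}_0(M)$ such that $\Phi_\Xi(\psi)([P])=\psi(P|_{M^1_\Xi},\xi)$ for every principal $\mathbb Z/2$-bundle $P\to M$ with a trivialization $\xi$ over $M^0_\Xi$. 3. For every refinement $\varphi\colon\Xi\to\Xi'$, $\mathcal P\circ\varphi_*$ maps $L(\Xi)$ to $L(\Xi')$ and $\Phi_{\Xi'}\circ\mathcal P\circ\varphi_*=\Phi_\Xi$ on $L(\Xi)$. 4.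 For every $f\in\mathrm{Diff}(M)$ and every $\Xi$, $f_*$ maps $L(\Xi)$ to $L(f(\Xi))$ and $\Phi_{f(\Xi)}(f_*\psi)=f\cdot\Phi_\Xi(\psi)$ for all $\psi\in L(\Xi)$. 5. Let $\mathfrak L$ be a nonempty $\mathrm{Diff}(M)$-stable class of CW structures on $M$ any two of which are connected by a zigzag of refinements inside $\mathfrak L$ (for instance, any two have a common refinement in $\mathfrak L$), and let $Z(M)$ be the colimit of the spaces $L(\Xi)$, $\Xi\in\mathfrak L$, along the maps $\mathcal P\circ\varphi_*$. Then every canonical map $c_\Xi\colon L(\Xi)\to Z(M)$ is bijective, there is a linear representation of $\mathrm{MCG}(M)$ on $Z(M)$ with $f\cdot c_\Xi(\psi)=c_{f(\Xi)}(f_*\psi)$, and the maps $\Phi_\Xi$ induce an $\mathrm{MCG}(M)$-equivariant isomorphism $Z(M)\cong\mathrm{DW}_0(M)$. -/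

import Mathlib

open Set Topology Bundle
open scoped Manifold ContDiff

universe u

/-! ### Principal `ℤ/2`-bundles -/

/-- A principal `ℤ/2`-bundle over `X`: a space with a continuous fibrewise action of `ℤ/2` which
is locally equivariantly homeomorphic, over `X`, to `U × ℤ/2` (`ZMod 2` is discrete). -/
structure PrincipalBundle (X : Type u) [TopologicalSpace X] where
  total : Type u
  [topology : TopologicalSpace total]
  [action : AddAction (ZMod 2) total]
  proj : total → X
  continuous_vadd : ∀ a : ZMod 2, Continuous fun p : total => a +ᵥ p
  proj_vadd : ∀ (a : ZMod 2) (p : total), proj (a +ᵥ p) = proj p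
  locally_trivial : ∀ x : X, ∃ e : Trivialization (ZMod 2) proj, x ∈ e.baseSet ∧
    ∀ (a : ZMod 2) (p : total), proj p ∈ e.baseSet → (e (a +ᵥ p)).2 = a + (e p).2

namespace PrincipalBundle

attribute [instance] PrincipalBundle.topology PrincipalBundle.action

variable {X Y Z : Type u} [TopologicalSpace X] [TopologicalSpace Y] [TopologicalSpace Z]

/-- Isomorphisms of principal bundles over `X`: equivariant homeomorphisms over `X`. -/
structure Iso (P Q : PrincipalBundle X) where
  toHomeomorph : P.total ≃ₜ Q.total
  proj_eq : ∀ p, Q.proj (toHomeomorph p) = P.proj p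
  map_vadd : ∀ (a : ZMod 2) (p : P.total), toHomeomorph (a +ᵥ p) = a +ᵥ toHomeomorph p

namespace Iso

def refl (P : PrincipalBundle X) : Iso P P where
  toHomeomorph := Homeomorph.refl _
  proj_eq _ := rfl
  map_vadd _ _ := rfl

def symm {P Q : PrincipalBundle X} (φ : Iso P Q) : Iso Q P where
  toHomeomorph := φ.toHomeomorph.symm
  proj_eq q := by
    rw [← φ.proj_eq, Homeomorph.apply_symm_apply]
  map_vadd a q := by
    apply φ.toHomeomorph.injective
    rw [φ.map_vadd, Homeomorph.apply_symm_apply, Homeomorph.apply_symm_apply]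

def trans {P Q R : PrincipalBundle X} (φ : Iso P Q) (χ : Iso Q R) : Iso P R where
  toHomeomorph := φ.toHomeomorph.trans χ.toHomeomorph
  proj_eq p := by
    rw [Homeomorph.trans_apply, χ.proj_eq, φ.proj_eq]
  map_vadd a p := by
    simp only [Homeomorph.trans_apply, φ.map_vadd, χ.map_vadd]

theorem ext {P Q : PrincipalBundle X} {φ χ : Iso P Q}
    (h : ∀ p, φ.toHomeomorph p = χ.toHomeomorph p) : φ = χ := by
  cases φ; cases χ
  congr
  exact Homeomorph.ext h

end Iso

/-- The projection is continuous. -/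
theorem continuous_proj (P : PrincipalBundle X) : Continuous P.proj := by
  rw [continuous_iff_continuousAt]
  intro p
  obtain ⟨e, he, -⟩ := P.locally_trivial (P.proj p)
  exact e.continuousAt_proj (e.mem_source.2 he)

/-- The pullback of a principal bundle along a continuous map. -/
def pullback (g : C(Y, X)) (P : PrincipalBundle X) : PrincipalBundle Y where
  total := {q : Y × P.total // g q.1 = P.proj q.2}
  action :=
    { vadd := fun a q => ⟨(q.1.1, a +ᵥ q.1.2), by rw [P.proj_vadd]; exact q.2⟩
      zero_vadd := fun q => Subtype.ext (Prod.ext rfl (zero_vadd _ q.1.2))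
      add_vadd := fun a b q => Subtype.ext (Prod.ext rfl (add_vadd a b q.1.2)) }
  proj q := q.1.1
  continuous_vadd a := by
    refine Continuous.subtype_mk ?_ _
    exact (continuous_fst.comp continuous_subtype_val).prodMk
      ((P.continuous_vadd a).comp (continuous_snd.comp continuous_subtype_val))
  proj_vadd a q := rfl
  locally_trivial y := by
    obtain ⟨e, he, hequiv⟩ := P.locally_trivial (g y)
    refine ⟨{ toFun := fun q => (q.1.1, (e q.1.2).2)
              invFun := fun z =>
                haveI := Classical.propDecidable (g z.1 ∈ e.baseSet)
                if h : g z.1 ∈ e.baseSet then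
                  ⟨(z.1, e.toOpenPartialHomeomorph.symm (g z.1, z.2)),
                    (e.proj_symm_apply' h).symm⟩
                else ⟨(y, e.toOpenPartialHomeomorph.symm (g y, 0)),
                  (e.proj_symm_apply' he).symm⟩
              source := (fun q => q.1.1) ⁻¹' (g ⁻¹' e.baseSet)
              target := (g ⁻¹' e.baseSet) ×ˢ univ
              map_source' := fun q hq => ⟨hq, trivial⟩
              map_target' := ?_
              left_inv' := ?_
              right_inv' := ?_
              open_source := (e.open_baseSet.preimage g.continuous).preimage
                (continuous_fst.comp continuous_subtype_val)
              open_target := (e.open_baseSet.preimage g.continuous).prod isOpen_univ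
              continuousOn_toFun := ?_
              continuousOn_invFun := ?_
              baseSet := g ⁻¹' e.baseSet
              open_baseSet := e.open_baseSet.preimage g.continuous
              source_eq := rfl
              target_eq := rfl
              proj_toFun := fun _ _ => rfl }, he, ?_⟩
    · rintro z ⟨hz, -⟩
      have hz' : g z.1 ∈ e.baseSet := hz
      simp only [dif_pos hz']
      exact hz
    · intro q hq
      have hq' : g q.1.1 ∈ e.baseSet := hq
      simp only [dif_pos hq']
      apply Subtype.ext
      refine Prod.ext rfl ?_
      have hs : q.1.2 ∈ e.source := by
        rw [e.mem_source, ← q.2]; exact hq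
      have h1 : (g q.1.1, (e q.1.2).2) = e q.1.2 :=
        Prod.ext (by rw [e.coe_fst hs]; exact q.2) rfl
      change e.toOpenPartialHomeomorph.symm (g q.1.1, (e q.1.2).2) = q.1.2
      rw [h1]
      exact e.toOpenPartialHomeomorph.left_inv hs
    · rintro z ⟨hz, -⟩
      have hz' : g z.1 ∈ e.baseSet := hz
      simp only [dif_pos hz']
      refine Prod.ext rfl ?_
      change (e (e.toOpenPartialHomeomorph.symm (g z.1, z.2))).2 = z.2
      rw [e.apply_symm_apply' hz']
    · refine (continuous_fst.comp continuous_subtype_val).continuousOn.prodMk ?_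
      refine continuous_snd.comp_continuousOn (e.continuousOn_toFun.comp
        (continuous_snd.comp continuous_subtype_val).continuousOn ?_)
      intro q hq
      change q.1.2 ∈ e.source
      rw [e.mem_source, ← q.2]; exact hq
    · refine (Topology.IsInducing.subtypeVal
        (t := {q : Y × P.total | g q.1 = P.proj q.2})).continuousOn_iff.2 ?_
      have : ContinuousOn (fun z : Y × ZMod 2 =>
          (z.1, e.toOpenPartialHomeomorph.symm (g z.1, z.2))) ((g ⁻¹' e.baseSet) ×ˢ univ) := by
        refine continuousOn_fst.prodMk (e.continuousOn_invFun.comp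
          ((g.continuous.comp continuous_fst).prodMk continuous_snd).continuousOn ?_)
        rintro z ⟨hz, -⟩
        rw [e.target_eq]
        exact ⟨hz, trivial⟩
      refine this.congr ?_
      rintro z ⟨hz, -⟩
      have hz' : g z.1 ∈ e.baseSet := hz
      simp only [Function.comp, dif_pos hz']
    · intro a q hq
      refine hequiv a q.1.2 ?_
      rw [← q.2]
      exact hq

/-- Pullback is functorial on isomorphisms. -/
def Iso.pullback (g : C(Y, X)) {P Q : PrincipalBundle X} (φ : Iso P Q) :
    Iso (P.pullback g) (Q.pullback g) where
  toHomeomorph :=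
    { toFun := fun q => ⟨(q.1.1, φ.toHomeomorph q.1.2), by
        exact q.2.trans (φ.proj_eq q.1.2).symm⟩
      invFun := fun q => ⟨(q.1.1, φ.toHomeomorph.symm q.1.2), by
        exact q.2.trans (φ.symm.proj_eq q.1.2).symm⟩
      left_inv := fun q => Subtype.ext (Prod.ext rfl (φ.toHomeomorph.symm_apply_apply _))
      right_inv := fun q => Subtype.ext (Prod.ext rfl (φ.toHomeomorph.apply_symm_apply _))
      continuous_toFun := by
        refine Continuous.subtype_mk ?_ _
        exact (continuous_fst.comp continuous_subtype_val).prodMk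
          (φ.toHomeomorph.continuous.comp (continuous_snd.comp continuous_subtype_val))
      continuous_invFun := by
        refine Continuous.subtype_mk ?_ _
        exact (continuous_fst.comp continuous_subtype_val).prodMk
          (φ.toHomeomorph.symm.continuous.comp (continuous_snd.comp continuous_subtype_val)) }
  proj_eq _ := rfl
  map_vadd a q := Subtype.ext (Prod.ext rfl (φ.map_vadd a q.1.2))

/-- Isomorphism of principal bundles over `X`. -/
instance setoid (X : Type u) [TopologicalSpace X] : Setoid (PrincipalBundle X) where
  r P Q := Nonempty (Iso P Q)
  iseqv := ⟨fun P => ⟨Iso.refl P⟩, fun ⟨φ⟩ => ⟨φ.symm⟩, fun ⟨φ⟩ ⟨χ⟩ => ⟨φ.trans χ⟩⟩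

/-- The holonomy of `P` around a loop `γ : S → X`, where `S` is a circle: it is `0` if the
pullback of `P` along `γ` is trivial, i.e. has a section, and `1` otherwise. -/
noncomputable def holonomy {S : Type*} [TopologicalSpace S] (P : PrincipalBundle X)
    (γ : C(S, X)) : ZMod 2 :=
  haveI := Classical.propDecidable (∃ s : C(S, P.total), ∀ z, P.proj (s z) = γ z)
  if ∃ s : C(S, P.total), ∀ z, P.proj (s z) = γ z then 0 else 1

theorem holonomy_congr {S : Type*} [TopologicalSpace S] {P Q : PrincipalBundle X}
    (φ : Iso P Q) (γ : C(S, X)) : P.holonomy γ = Q.holonomy γ := by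
  have h : ∀ {P Q : PrincipalBundle X} (_ : Iso P Q),
      (∃ s : C(S, P.total), ∀ z, P.proj (s z) = γ z) →
      ∃ s : C(S, Q.total), ∀ z, Q.proj (s z) = γ z := by
    rintro P Q φ ⟨s, hs⟩
    exact ⟨⟨fun z => φ.toHomeomorph (s z), φ.toHomeomorph.continuous.comp s.continuous⟩,
      fun z => (φ.proj_eq _).trans (hs z)⟩
  unfold holonomy
  by_cases hP : ∃ s : C(S, P.total), ∀ z, P.proj (s z) = γ z
  · rw [if_pos hP, if_pos (h φ hP)]
  · rw [if_neg hP, if_neg fun hQ => hP (h φ.symm hQ)]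

end PrincipalBundle

/-- `π₀` of the groupoid of principal `ℤ/2`-bundles on `X`. -/
def BunClass (X : Type u) [TopologicalSpace X] : Type (u + 1) :=
  Quotient (PrincipalBundle.setoid X)

namespace BunClass

variable {X Y : Type u} [TopologicalSpace X] [TopologicalSpace Y]

/-- The isomorphism class of a principal bundle. -/
def mk (P : PrincipalBundle X) : BunClass X := Quotient.mk _ P

/-- Pullback of isomorphism classes of principal bundles along a continuous map. -/
def pullback (g : C(Y, X)) : BunClass X → BunClass Y :=
  Quotient.map (PrincipalBundle.pullback g) fun _ _ ⟨φ⟩ => ⟨φ.pullback g⟩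

/-- The number of automorphisms of a principal bundle in a given isomorphism class. -/
noncomputable def autCard : BunClass X → ℕ :=
  Quotient.lift (fun P : PrincipalBundle X => Nat.card (P.Iso P)) fun P Q ⟨φ⟩ =>
    Nat.card_congr
      { toFun := fun α => (φ.symm.trans α).trans φ
        invFun := fun α => (φ.trans α).trans φ.symm
        left_inv := fun α => PrincipalBundle.Iso.ext fun p => by
          simp [PrincipalBundle.Iso.trans, PrincipalBundle.Iso.symm]
        right_inv := fun α => PrincipalBundle.Iso.ext fun p => by
          simp [PrincipalBundle.Iso.trans, PrincipalBundle.Iso.symm] }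

end BunClass

/-! ### Principal bundles with a trivialization over a subspace -/

/-- A principal `ℤ/2`-bundle on `X` with a trivialization (a section) over the subspace `A`. -/
structure RelBundle (X : Type u) [TopologicalSpace X] (A : Set X) where
  bundle : PrincipalBundle X
  triv : C(A, bundle.total)
  proj_triv : ∀ a : A, bundle.proj (triv a) = a

namespace RelBundle

variable {X Y : Type u} [TopologicalSpace X] [TopologicalSpace Y] {A : Set X} {B : Set Y}

/-- Isomorphisms preserve the trivializations. -/
instance setoid (X : Type u) [TopologicalSpace X] (A : Set X) : Setoid (RelBundle X A) where
  r E F := ∃ φ : E.bundle.Iso F.bundle, ∀ a, φ.toHomeomorph (E.triv a) = F.triv a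
  iseqv := by
    refine ⟨fun E => ⟨PrincipalBundle.Iso.refl _, fun _ => rfl⟩, ?_, ?_⟩
    · rintro E F ⟨φ, h⟩
      exact ⟨φ.symm, fun a => by
        rw [← h]; exact φ.toHomeomorph.symm_apply_apply _⟩
    · rintro E F G ⟨φ, h⟩ ⟨χ, k⟩
      refine ⟨φ.trans χ, fun a => ?_⟩
      rw [← k, ← h]
      rfl

/-- The pullback along a map of pairs `(Y, B) → (X, A)`. -/
def pullback (g : C(Y, X)) (hg : MapsTo g B A) (E : RelBundle X A) : RelBundle Y B where
  bundle := E.bundle.pullback g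
  triv :=
    { toFun := fun b => ⟨(b.1, E.triv ⟨g b.1, hg b.2⟩), (E.proj_triv ⟨g b.1, hg b.2⟩).symm⟩
      continuous_toFun := by
        refine Continuous.subtype_mk (continuous_subtype_val.prodMk (E.triv.continuous.comp ?_)) _
        exact Continuous.subtype_mk (g.continuous.comp continuous_subtype_val) _ }
  proj_triv _ := rfl

/-- Change the trivialization `ξ` to `ξ + t`. -/
def shift (t : C(A, ZMod 2)) (E : RelBundle X A) : RelBundle X A where
  bundle := E.bundle
  triv :=
    { toFun := fun a => t a +ᵥ E.triv a
      continuous_toFun := by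
        rw [continuous_iff_continuousAt]
        intro a
        have h1 : ContinuousAt (fun b => t a +ᵥ E.triv b) a :=
          ((E.bundle.continuous_vadd (t a)).comp E.triv.continuous).continuousAt
        refine h1.congr ?_
        have h2 : t ⁻¹' {t a} ∈ 𝓝 a :=
          ((isOpen_discrete {t a}).preimage t.continuous).mem_nhds rfl
        filter_upwards [h2] with b hb
        have hb' : t b = t a := hb
        rw [hb'] }
  proj_triv a := by
    change E.bundle.proj (t a +ᵥ E.triv a) = a
    rw [E.bundle.proj_vadd, E.proj_triv]

end RelBundle

/-- `π₀` of the groupoid of principal `ℤ/2`-bundles on `X` trivialized over `A`. -/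
def RelBunClass (X : Type u) [TopologicalSpace X] (A : Set X) : Type (u + 1) :=
  Quotient (RelBundle.setoid X A)

namespace RelBunClass

variable {X Y : Type u} [TopologicalSpace X] [TopologicalSpace Y] {A : Set X} {B : Set Y}

/-- The isomorphism class of a trivialized bundle. -/
def mk (E : RelBundle X A) : RelBunClass X A := Quotient.mk _ E

/-- Pullback of isomorphism classes along a map of pairs. -/
def pullback (g : C(Y, X)) (hg : MapsTo g B A) : RelBunClass X A → RelBunClass Y B :=
  Quotient.map (RelBundle.pullback g hg) fun _ _ h => by
    obtain ⟨φ, h⟩ := h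
    exact ⟨PrincipalBundle.Iso.pullback g φ,
      fun b => Subtype.ext (Prod.ext rfl (h ⟨g b.1, hg b.2⟩))⟩

/-- `[P, ξ] ↦ [P, ξ + t]`. -/
def shift (t : C(A, ZMod 2)) : RelBunClass X A → RelBunClass X A :=
  Quotient.map (RelBundle.shift t) fun E F ⟨φ, h⟩ => ⟨φ, fun a => by
    change φ.toHomeomorph (t a +ᵥ E.triv a) = t a +ᵥ F.triv a
    rw [φ.map_vadd, h]⟩

/-- The holonomy of the underlying bundle around a loop. -/
noncomputable def holonomy {S : Type*} [TopologicalSpace S] (γ : C(S, X)) :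
    RelBunClass X A → ZMod 2 :=
  Quotient.lift (fun E : RelBundle X A => E.bundle.holonomy γ) fun _ _ ⟨φ, _⟩ =>
    PrincipalBundle.holonomy_congr φ γ

end RelBunClass

/-! ### CW structures -/

/-- A CW structure on the topological space `M`. -/
abbrev CWStructure (M : Type u) [TopologicalSpace M] : Type (u + 1) :=
  CWComplex (univ : Set M)

namespace CWStructure

variable {M : Type u} [TopologicalSpace M] [T2Space M] (Ξ : CWStructure M)

/-- The set of `k`-cells. -/
abbrev Cell {M : Type u} [TopologicalSpace M] (Ξ : CWStructure M) (k : ℕ) : Type u :=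
  Topology.CWComplex.cell (self := Ξ) (univ : Set M) k

/-- The characteristic map of a `k`-cell; `Fin k → ℝ` carries the maximum norm. -/
abbrev charMap {M : Type u} [TopologicalSpace M] (Ξ : CWStructure M) {k : ℕ} (c : Ξ.Cell k) :
    PartialEquiv (Fin k → ℝ) M :=
  Topology.CWComplex.map (self := Ξ) k c

/-- The open `k`-cell of index `c`. -/
def openCell {M : Type u} [TopologicalSpace M] (Ξ : CWStructure M) {k : ℕ} (c : Ξ.Cell k) :
    Set M :=
  Ξ.charMap c '' Metric.ball 0 1

/-- The `k`-skeleton. -/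
def skel (k : ℕ) : Set M :=
  letI := Ξ
  (RelCWComplex.skeleton (univ : Set M) k : Set M)

/-- The `0`-skeleton, as a subset of the `1`-skeleton. -/
def skel₀ : Set (Ξ.skel 1) := {x | (x : M) ∈ Ξ.skel 0}

theorem mem_skel_iff {k : ℕ} {x : M} :
    x ∈ Ξ.skel k ↔ ∃ m ≤ k, ∃ c : Ξ.Cell m, x ∈ Ξ.openCell c := by
  let := Ξ
  refine (CWComplex.mem_skeleton_iff (C := (univ : Set M)) (n := (k : ℕ∞)) (x := x)).trans ?_
  simp only [Nat.cast_le, exists_prop]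
  rfl

theorem skel_mono {j k : ℕ} (h : j ≤ k) : Ξ.skel j ⊆ Ξ.skel k := by
  intro x hx
  obtain ⟨m, hm, c, hc⟩ := (Ξ.mem_skel_iff).1 hx
  exact (Ξ.mem_skel_iff).2 ⟨m, hm.trans h, c, hc⟩

/-- A CW structure on a compact Hausdorff space has finitely many cells. -/
theorem finite_cells [CompactSpace M] : Finite (Σ k, Ξ.Cell k) := by
  let := Ξ
  let x : (Σ k, Ξ.Cell k) → M := fun s => Ξ.charMap s.2 0
  have hx : ∀ s, x s ∈ Ξ.openCell s.2 := fun s =>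
    mem_image_of_mem _ (Metric.mem_ball_self one_pos)
  have hdisj : ∀ s t : (Σ k, Ξ.Cell k), x s ∈ Ξ.openCell t.2 → s = t := by
    intro s t h
    by_contra hne
    have hd : Disjoint (Ξ.openCell s.2) (Ξ.openCell t.2) :=
      Topology.CWComplex.pairwiseDisjoint' (self := Ξ) (mem_univ s) (mem_univ t) hne
    exact Set.disjoint_left.1 hd (hx s) h
  have hinj : Function.Injective x := fun s t h => hdisj s t (h ▸ hx t)
  have hcl : ∀ A ⊆ range x, IsClosed A := by
    intro A hA
    refine Topology.CWComplex.closed' (self := Ξ) A (subset_univ _) fun n j => ?_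
    refine Set.Finite.isClosed ?_
    obtain ⟨I, hI⟩ : ∃ I : ∀ m, Set (Ξ.Cell m), (∀ m, (I m).Finite) ∧
        Ξ.charMap j '' Metric.closedBall 0 1 ⊆ ⋃ (m) (_ : m ≤ n) (c) (_ : c ∈ I m), Ξ.openCell c := by
      obtain ⟨I, hI⟩ :=
        CWComplex.cellFrontier_subset_finite_openCell (C := (univ : Set M)) n j
      refine ⟨fun m => (I m : Set (Ξ.Cell m)) ∪ {c | (⟨m, c⟩ : Σ k, Ξ.Cell k) = ⟨n, j⟩},
        fun m => (I m).finite_toSet.union (Set.Subsingleton.finite ?_), ?_⟩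
      · intro c hc c' hc'
        exact sigma_mk_injective (hc.trans hc'.symm)
      · rw [← Metric.sphere_union_ball, image_union]
        refine union_subset ?_ ?_
        · intro y hy
          have := hI hy
          simp only [mem_iUnion] at this ⊢
          obtain ⟨m, hm, c, hc, hmem⟩ := this
          exact ⟨m, hm.le, c, Or.inl hc, hmem⟩
        · intro y hy
          simp only [mem_iUnion]
          exact ⟨n, le_rfl, j, Or.inr rfl, hy⟩
    have hfin : (x '' ⋃ m ∈ Finset.range (n + 1), (fun c => (⟨m, c⟩ : Σ k, Ξ.Cell k)) ''
        I m).Finite :=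
      ((Finset.range (n + 1)).finite_toSet.biUnion fun m _ =>
        (hI.1 m).image _).image _
    refine hfin.subset ?_
    rintro y ⟨hyA, hyc⟩
    obtain ⟨s, rfl⟩ := hA hyA
    have := hI.2 hyc
    simp only [mem_iUnion, exists_prop] at this
    obtain ⟨m, hm, c, hc, hmem⟩ := this
    obtain rfl := hdisj s ⟨m, c⟩ hmem
    refine mem_image_of_mem _ ?_
    simp only [mem_iUnion]
    exact ⟨m, Finset.mem_range.2 (Nat.lt_succ_of_le hm), c, hc, rfl⟩
  have hdisc : DiscreteTopology (range x) := by
    refine discreteTopology_iff_forall_isClosed.2 fun A => ?_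
    have := hcl (Subtype.val '' A) (by rintro _ ⟨a, -, rfl⟩; exact a.2)
    rw [← Set.preimage_image_eq A Subtype.val_injective]
    exact this.preimage continuous_subtype_val
  have hcomp : CompactSpace (range x) := isCompact_iff_compactSpace.1 (hcl _ subset_rfl).isCompact
  have hf : Finite (range x) := finite_of_compact_of_discrete
  exact Finite.of_injective (fun s => (⟨x s, s, rfl⟩ : range x))
    fun s t h => hinj (congrArg Subtype.val h)

instance finite_cell [CompactSpace M] (k : ℕ) : Finite (Ξ.Cell k) :=
  haveI := Ξ.finite_cells
  Finite.of_injective (fun c : Ξ.Cell k => (⟨k, c⟩ : Σ k, Ξ.Cell k)) sigma_mk_injective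

noncomputable instance fintype_cell [CompactSpace M] (k : ℕ) : Fintype (Ξ.Cell k) :=
  Fintype.ofFinite _

instance finite_skel₀ [CompactSpace M] : Finite Ξ.skel₀ := by
  have h : (Ξ.skel 0).Finite := by
    refine (Set.finite_range fun c : Ξ.Cell 0 => Ξ.charMap c 0).subset ?_
    intro x hx
    obtain ⟨m, hm, c, z, -, hz⟩ := (Ξ.mem_skel_iff).1 hx
    obtain rfl : m = 0 := Nat.le_zero.1 hm
    exact ⟨c, by rw [← hz, Subsingleton.elim z 0]⟩
  exact (h.preimage Subtype.val_injective.injOn).to_subtype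

/-- The indicator function `δ_v` of a vertex `v`, as a function on the `0`-skeleton. -/
noncomputable def delta [CompactSpace M] (v : Ξ.Cell 0) : C(Ξ.skel₀, ZMod 2) where
  toFun x :=
    haveI := Classical.propDecidable (((x : Ξ.skel 1) : M) = Ξ.charMap v 0)
    if ((x : Ξ.skel 1) : M) = Ξ.charMap v 0 then 1 else 0
  continuous_toFun := continuous_of_discreteTopology

/-- The attaching map `∂f` of a `2`-cell `f`, a loop in the `1`-skeleton. -/
def attach (f : Ξ.Cell 2) : C(Metric.sphere (0 : Fin 2 → ℝ) 1, Ξ.skel 1) where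
  toFun z := ⟨Ξ.charMap f z, by
    let := Ξ
    exact CWComplex.cellFrontier_subset_skeleton (C := (univ : Set M)) 1
      (show RelCWComplex.cell (univ : Set M) (1 + 1) from f) (mem_image_of_mem _ z.2)⟩
  continuous_toFun := by
    refine Continuous.subtype_mk ?_ _
    exact continuousOn_iff_continuous_domRestrict.1
      ((Topology.CWComplex.continuousOn (self := Ξ) 2 f).mono Metric.sphere_subset_closedBall)

/-- `Ξ'` refines `Ξ`: each open cell of `Ξ` is a union of open cells of `Ξ'` of at most the same
dimension. -/
def Refines {M : Type u} [TopologicalSpace M] (Ξ Ξ' : CWStructure M) : Prop :=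
  ∀ (k : ℕ) (c : Ξ.Cell k), ∃ S : Set (Σ m, Ξ'.Cell m),
    (∀ s ∈ S, s.1 ≤ k) ∧ Ξ.openCell c = ⋃ s ∈ S, Ξ'.openCell s.2

variable {Ξ} in
theorem Refines.skel_subset {Ξ' : CWStructure M} (h : Refines Ξ Ξ') (k : ℕ) :
    Ξ.skel k ⊆ Ξ'.skel k := by
  intro x hx
  obtain ⟨m, hm, c, hc⟩ := (Ξ.mem_skel_iff).1 hx
  obtain ⟨S, hS, hcS⟩ := h m c
  rw [hcS] at hc
  simp only [mem_iUnion] at hc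
  obtain ⟨s, hs, hxs⟩ := hc
  exact (Ξ'.mem_skel_iff).2 ⟨s.1, (hS s hs).trans hm, s.2, hxs⟩

/-- The image `f(Ξ)` of a CW structure under a homeomorphism: the characteristic maps are
composed with `f`. -/
@[reducible]
def image {M : Type u} [TopologicalSpace M] (f : M ≃ₜ M) (Ξ : CWStructure M) : CWStructure M where
  cell := Topology.CWComplex.cell (self := Ξ) (univ : Set M)
  map n i := (Topology.CWComplex.map (self := Ξ) n i).transEquiv f.toEquiv
  source_eq n i := Topology.CWComplex.source_eq (self := Ξ) n i
  continuousOn n i :=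
    f.continuous.comp_continuousOn (Topology.CWComplex.continuousOn (self := Ξ) n i)
  continuousOn_symm n i :=
    (Topology.CWComplex.continuousOn_symm (self := Ξ) n i).comp
      f.symm.continuous.continuousOn fun _ hx => hx
  pairwiseDisjoint' := by
    intro s hs t ht hne
    have h := Topology.CWComplex.pairwiseDisjoint' (self := Ξ) hs ht hne
    have h' := (Set.disjoint_image_iff f.injective).2 h
    simp only [← Set.image_comp] at h'
    exact h'
  mapsTo' n i := by
    obtain ⟨I, hI⟩ := Topology.CWComplex.mapsTo' (self := Ξ) n i
    refine ⟨I, fun z hz => ?_⟩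
    have := hI hz
    simp only [mem_iUnion] at this ⊢
    obtain ⟨m, hm, j, hj, w, hw, hwz⟩ := this
    exact ⟨m, hm, j, hj, w, hw, congrArg f hwz⟩
  closed' A hA h := by
    rw [← f.isClosed_preimage]
    refine Topology.CWComplex.closed' (self := Ξ) _ (subset_univ _) fun n j => ?_
    have h1 := (h n j).preimage f.continuous
    convert h1 using 1
    ext x
    refine and_congr Iff.rfl ⟨?_, ?_⟩
    · rintro ⟨w, hw, rfl⟩
      exact ⟨w, hw, rfl⟩
    · rintro ⟨w, hw, hwx⟩
      exact ⟨w, hw, f.injective hwx⟩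
  union' := by
    rw [eq_univ_iff_forall]
    intro x
    have h := Topology.CWComplex.union' (self := Ξ)
    have hx : f.symm x ∈ (univ : Set M) := trivial
    rw [← h] at hx
    simp only [mem_iUnion] at hx ⊢
    obtain ⟨n, j, w, hw, hwx⟩ := hx
    exact ⟨n, j, w, hw, (congrArg f hwx).trans (f.apply_symm_apply x)⟩

theorem map_mem_skel_image (f : M ≃ₜ M) {k : ℕ} {x : M} (hx : x ∈ Ξ.skel k) :
    f x ∈ (Ξ.image f).skel k := by
  obtain ⟨m, hm, c, w, hw, rfl⟩ := (Ξ.mem_skel_iff).1 hx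
  exact ((Ξ.image f).mem_skel_iff).2 ⟨m, hm, c, w, hw, rfl⟩

end CWStructure

/-! ### The toric code -/

namespace ToricCode

open CWStructure

variable {M : Type u} [TopologicalSpace M] [T2Space M] (Ξ : CWStructure M)

/-- The isomorphism classes of fields: `π₀ Bun(M¹, M⁰)`. -/
abbrev Field : Type (u + 1) := RelBunClass (Ξ.skel 1) Ξ.skel₀

/-- The state space `ℂ[Bun(M¹, M⁰)]`: functions on the groupoid of fields. -/
abbrev State : Type (u + 1) := Field Ξ → ℂ

/-- The pullback of fields `φ^* : Bun(M¹_Ξ', M⁰_Ξ') → Bun(M¹_Ξ, M⁰_Ξ)` along a refinement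
`φ : Ξ → Ξ'`. -/
def restrictField {Ξ Ξ' : CWStructure M} (h : Ξ.Refines Ξ') : Field Ξ' → Field Ξ :=
  RelBunClass.pullback
    ⟨fun x => ⟨x.1, h.skel_subset 1 x.2⟩, continuous_subtype_val.subtype_mk _⟩
    fun _ hx => h.skel_subset 0 hx

/-- The pushforward `φ_*` of states along a refinement `φ : Ξ → Ξ'`. -/
def refinePush {Ξ Ξ' : CWStructure M} (h : Ξ.Refines Ξ') : State Ξ →ₗ[ℂ] State Ξ' :=
  LinearMap.funLeft ℂ ℂ (restrictField h)

/-- The projection `𝒫` which sets a state to zero on the bundles with nontrivial holonomy around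
the boundary of some `2`-cell. -/
noncomputable def holProj : State Ξ →ₗ[ℂ] State Ξ :=
  haveI := fun E : Field Ξ => Classical.propDecidable (∀ f, E.holonomy (Ξ.attach f) = 0)
  LinearMap.mulLeft ℂ fun E : Field Ξ => if ∀ f, E.holonomy (Ξ.attach f) = 0 then (1 : ℂ) else 0

/-- The pushforward `f_* : ℋ(Ξ) → ℋ(f(Ξ))` along a homeomorphism,
`(f_* ψ)(P, ξ) = ψ(f^* P, f^* ξ)`. -/
def homeoPush (f : M ≃ₜ M) : State Ξ →ₗ[ℂ] State (Ξ.image f) :=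
  LinearMap.funLeft ℂ ℂ (RelBunClass.pullback
    ⟨fun x : Ξ.skel 1 => (⟨f x.1, Ξ.map_mem_skel_image f x.2⟩ : (Ξ.image f).skel 1),
      (f.continuous.comp continuous_subtype_val).subtype_mk _⟩
    fun _ hx => Ξ.map_mem_skel_image f hx)

/-- The restriction to `(M¹, M⁰)` of a bundle on `M` trivialized over `M⁰`. -/
def fieldOfBundle (E : RelBundle M (Ξ.skel 0)) : Field Ξ :=
  RelBunClass.mk (E.pullback (B := Ξ.skel₀) ⟨Subtype.val, continuous_subtype_val⟩ fun _ hx => hx)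

variable [CompactSpace M]

/-- The shift operator `A_v`, `(A_v ψ)(P, ξ) = ψ(P, ξ + δ_v)`. -/
noncomputable def shiftOp (v : Ξ.Cell 0) : State Ξ →ₗ[ℂ] State Ξ :=
  LinearMap.funLeft ℂ ℂ (RelBunClass.shift (Ξ.delta v))

/-- The operator `B_f`: multiplication by `(-1)` to the holonomy around `∂f`. -/
noncomputable def holOp (f : Ξ.Cell 2) : State Ξ →ₗ[ℂ] State Ξ :=
  LinearMap.mulLeft ℂ (fun E : Field Ξ => (-1 : ℂ) ^ (E.holonomy (Ξ.attach f)).val)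

/-- The vertex operator `H_v = (1 - A_v) / 2`. -/
noncomputable def vertexOp (v : Ξ.Cell 0) : State Ξ →ₗ[ℂ] State Ξ :=
  (1 / 2 : ℂ) • (LinearMap.id - shiftOp Ξ v)

/-- The face operator `H_f = (1 - B_f) / 2`. -/
noncomputable def faceOp (f : Ξ.Cell 2) : State Ξ →ₗ[ℂ] State Ξ :=
  (1 / 2 : ℂ) • (LinearMap.id - holOp Ξ f)

/-- The Hamiltonian of the toric code. -/
noncomputable def hamiltonian : State Ξ →ₗ[ℂ] State Ξ :=
  ∑ v : Ξ.Cell 0, vertexOp Ξ v + ∑ f : Ξ.Cell 2, faceOp Ξ f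

/-- The space of ground states: the kernel of the Hamiltonian. -/
noncomputable def groundStates : Submodule ℂ (State Ξ) := LinearMap.ker (hamiltonian Ξ)

/-- The direct sum of the spaces of ground states over a class `𝓛` of CW structures. -/
def GroundSum (𝓛 : Set (CWStructure M)) : Type (u + 1) :=
  DirectSum 𝓛 fun Ξ => groundStates Ξ.1

noncomputable instance (𝓛 : Set (CWStructure M)) : AddCommGroup (GroundSum 𝓛) :=
  inferInstanceAs (AddCommGroup (DirectSum 𝓛 fun Ξ => groundStates Ξ.1))

noncomputable instance (𝓛 : Set (CWStructure M)) : Module ℂ (GroundSum 𝓛) :=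
  inferInstanceAs (Module ℂ (DirectSum 𝓛 fun Ξ => groundStates Ξ.1))

open scoped Classical in
/-- The inclusion of a summand. -/
noncomputable def toSum (𝓛 : Set (CWStructure M)) (Ξ : 𝓛) :
    groundStates Ξ.1 →ₗ[ℂ] GroundSum 𝓛 :=
  DirectSum.lof ℂ 𝓛 (fun Ξ => groundStates Ξ.1) Ξ

/-- The linear relations defining the colimit, over the refinements in a class `𝓛` of CW
structures, of the spaces of ground states: `x` is identified with `𝒫 (φ_* x)`. -/
noncomputable def colimitRelations (𝓛 : Set (CWStructure M)) : Submodule ℂ (GroundSum 𝓛) :=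
  Submodule.span ℂ {z | ∃ (Ξ Ξ' : 𝓛) (h : Ξ.1.Refines Ξ'.1) (x : groundStates Ξ.1)
    (y : groundStates Ξ'.1), y.1 = holProj Ξ'.1 (refinePush h x.1) ∧
      z = toSum 𝓛 Ξ x - toSum 𝓛 Ξ' y}

/-- The colimit `Z(M)` of the spaces of ground states over the refinements in the class `𝓛`. -/
abbrev ColimitGround (𝓛 : Set (CWStructure M)) : Type (u + 1) :=
  GroundSum 𝓛 ⧸ colimitRelations 𝓛

/-- The canonical map `c_Ξ` from the ground states on `Ξ` to the colimit. -/
noncomputable def toColimit (𝓛 : Set (CWStructure M)) (Ξ : 𝓛) :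
    groundStates Ξ.1 →ₗ[ℂ] ColimitGround 𝓛 :=
  (colimitRelations 𝓛).mkQ ∘ₗ toSum 𝓛 Ξ

/-- Any two members of `𝓛` are connected by a chain of refinements, and inverses of refinements,
in `𝓛`; for example any two members have a common refinement in `𝓛`. -/
def RefinementConnected (𝓛 : Set (CWStructure M)) : Prop :=
  ∀ Ξ Ξ' : 𝓛, Relation.EqvGen (fun Θ Θ' : 𝓛 => Θ.1.Refines Θ'.1) Ξ Ξ'

end ToricCode

/-! ### Dijkgraaf-Witten theory with gauge group `ℤ/2` and zero Lagrangian -/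

/-- The state space of a closed manifold `N`: functions on `π₀ Bun(N)`. -/
abbrev DW₀ (N : Type u) [TopologicalSpace N] : Type (u + 1) := BunClass N → ℂ

namespace DW₀

variable {N N' W : Type u} [TopologicalSpace N] [TopologicalSpace N'] [TopologicalSpace W]

open scoped Classical in
/-- The push-pull map of a bordism `W` from `N` to `N'` with boundary inclusions `i` and `i'`: pull
back along `i`, then integrate over the fibres of `i'^* : Bun(W) → Bun(N')` with respect to
groupoid cardinality. The homotopy fibre over `Q` of the component of `P` has cardinality
`|Aut Q| / |Aut P|` if `i'^* P ≅ Q`. -/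
noncomputable def bordism (i : C(N, W)) (i' : C(N', W)) (Ψ : DW₀ N) : DW₀ N' := fun Q =>
  ∑ᶠ P : BunClass W,
    if P.pullback i' = Q then (Q.autCard : ℂ) / (P.autCard : ℂ) * Ψ (P.pullback i) else 0

/-- The map assigned to the mapping cylinder `C_f` of a homeomorphism `f` of `N`: the bordism
`[0, 1] × N` whose incoming boundary `{0} × N` is identified with `N` by the identity and whose
outgoing boundary `{1} × N` is identified with `N` by `f`. -/
noncomputable def mappingCylinder (f : N ≃ₜ N) : DW₀ N → DW₀ N :=
  bordism (W := unitInterval × N)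
    ⟨fun x => (0, x), continuous_const.prodMk continuous_id⟩
    ⟨fun x => (1, f.symm x), continuous_const.prodMk f.symm.continuous⟩

end DW₀

/-! ### Mapping class groups -/

/-- The group of self-diffeomorphisms of a smooth `d`-manifold. -/
abbrev Diff (d : ℕ) (M : Type u) [TopologicalSpace M]
    [ChartedSpace (EuclideanSpace ℝ (Fin d)) M] : Type u :=
  M ≃ₘ⟮𝓡 d, 𝓡 d⟯ M

namespace Diff

variable {d : ℕ} {M : Type u} [TopologicalSpace M] [ChartedSpace (EuclideanSpace ℝ (Fin d)) M]

noncomputable instance group : Group (Diff d M) where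
  mul f g := Diffeomorph.trans g f
  one := Diffeomorph.refl (𝓡 d) M ∞
  inv f := f.symm
  mul_assoc _ _ _ := rfl
  one_mul _ := rfl
  mul_one _ := rfl
  inv_mul_cancel f := f.self_trans_symm

theorem mul_apply (f g : Diff d M) (x : M) : (f * g) x = f (g x) := rfl

theorem inv_apply_self (f : Diff d M) (x : M) : f⁻¹ (f x) = x := f.symm_apply_apply x

theorem one_apply (x : M) : (1 : Diff d M) x = x := rfl

variable (d M) in
/-- `Diff₀(M)`: the diffeomorphisms that are smoothly isotopic to the identity. For closed `M` this
is the identity component of `Diff(M)`. -/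
def isotopicToId : Subgroup (Diff d M) where
  carrier := {f | ∃ F : ℝ → Diff d M, F 0 = 1 ∧ F 1 = f ∧
    ContMDiff (𝓘(ℝ, ℝ).prod (𝓡 d)) (𝓡 d) ∞ fun p : ℝ × M => F p.1 p.2}
  one_mem' := ⟨fun _ => 1, rfl, rfl, contMDiff_snd⟩
  mul_mem' := by
    rintro f g ⟨F, hF0, hF1, hF⟩ ⟨G, hG0, hG1, hG⟩
    exact ⟨fun t => F t * G t, by simp [hF0, hG0], by simp [hF1, hG1],
      hF.comp (contMDiff_fst.prodMk hG)⟩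
  inv_mem' := by
    rintro f ⟨F, hF0, hF1, hF⟩
    refine ⟨fun t => f⁻¹ * F (1 - t), by simp [hF1], by simp [hF0], ?_⟩
    have h1 : ContMDiff (𝓘(ℝ, ℝ).prod (𝓡 d)) 𝓘(ℝ, ℝ) ∞ fun p : ℝ × M => 1 - p.1 :=
      (contDiff_const.sub contDiff_id).contMDiff.comp contMDiff_fst
    exact (f⁻¹ : Diff d M).contMDiff.comp (hF.comp (h1.prodMk contMDiff_snd))

instance isotopicToId_normal : (isotopicToId d M).Normal where
  conj_mem := by
    rintro f ⟨F, hF0, hF1, hF⟩ g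
    refine ⟨fun t => g * F t * g⁻¹, by simp [hF0], by simp [hF1], ?_⟩
    exact g.contMDiff.comp (hF.comp (contMDiff_fst.prodMk
      ((g⁻¹ : Diff d M).contMDiff.comp contMDiff_snd)))

end Diff

/-- The mapping class group `Diff(M) / Diff₀(M)`. -/
abbrev MCG (d : ℕ) (M : Type u) [TopologicalSpace M]
    [ChartedSpace (EuclideanSpace ℝ (Fin d)) M] : Type u :=
  Diff d M ⧸ Diff.isotopicToId d M

/-! Both sides of the comparison are functions on `π₀ Bun(M)`.

On the lattice side, the `A_v` and `B_f` are commuting involutions, so the Hamiltonian is a sum of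
commuting idempotents and its kernel is the common fixed space (`mem_groundStates_iff_localOp`).
Being fixed by all `A_v` means independence of the trivialization over the vertices; being fixed by
all `B_f` means vanishing on bundles with holonomy around some face (`mem_groundStates_iff`). A
ground state is therefore a function on the classes of flat bundles on the 1-skeleton.

These classes are `π₀ Bun(M)` by obstruction theory, one skeleton at a time. Attaching spheres of
cells of dimension at least two are connected, so an isomorphism extends over such cells
(`pullback_skelVal_injective`). A bundle extends over a cell once it is trivial on the attaching
sphere: for 2-cells this is the holonomy condition, and for higher cells it is automatic
(`exists_extension`). The topological work is the gluing in `nonempty_iso_of_attachment` and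
`exists_extension_of_attachment`, where compactness makes the inclusion and characteristic maps
closed. Together these give `groundMap_bijective`; compatibility with refinements and
diffeomorphisms is functoriality of pullback.

On the field theory side, homotopy lifting shows that every bundle on `[0, 1] × M` is pulled back
from `M` (`nonempty_iso_cylinder`). The push-pull sum for a mapping cylinder thus has a single term,
with weight one as every bundle has as many automorphisms as there are locally constant functions to
`ℤ/2`. So `C_f` acts by pullback along `f`, and isotopic diffeomorphisms act equally.

The maps to `DW₀ M` form a cocone on the refinement diagram. They make each `c_Ξ` injective; zigzags
of refinements make it surjective. The action on the colimit is then transported from `DW₀ M`. -/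

namespace PrincipalBundle

variable {X Y Z : Type u} [TopologicalSpace X] [TopologicalSpace Y] [TopologicalSpace Z]
variable {T : Type*} [TopologicalSpace T]

/-! ### Fibres of principal bundles -/

theorem vadd_add_cancel (P : PrincipalBundle X) (a : ZMod 2) (p : P.total) :
    a +ᵥ a +ᵥ p = p := by
  rw [← add_vadd, CharTwo.add_self_eq_zero, zero_vadd]

theorem exists_vadd_eq (P : PrincipalBundle X) {p q : P.total} (h : P.proj p = P.proj q) :
    ∃ a : ZMod 2, a +ᵥ p = q := by
  obtain ⟨e, he, hv⟩ := P.locally_trivial (P.proj p)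
  refine ⟨(e q).2 - (e p).2, ?_⟩
  have hp : ((e q).2 - (e p).2) +ᵥ p ∈ e.source := by
    rw [e.mem_source, P.proj_vadd]; exact he
  have hq : q ∈ e.source := by rw [e.mem_source, ← h]; exact he
  refine e.injOn hp hq (Prod.ext ?_ ?_)
  · exact (e.coe_fst hp).trans (((P.proj_vadd _ p).trans h).trans (e.coe_fst hq).symm)
  · exact (hv _ _ he).trans (sub_add_cancel _ _)

theorem vadd_right_inj (P : PrincipalBundle X) {a b : ZMod 2} {p : P.total} :
    a +ᵥ p = b +ᵥ p ↔ a = b := by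
  refine ⟨fun h => ?_, fun h => by rw [h]⟩
  obtain ⟨e, he, hv⟩ := P.locally_trivial (P.proj p)
  have := congrArg (fun q => (e q).2) h
  simpa only [hv _ _ he, add_left_inj] using this

theorem proj_surjective (P : PrincipalBundle X) : Function.Surjective P.proj := by
  intro x
  obtain ⟨e, he, -⟩ := P.locally_trivial x
  exact ⟨e.toOpenPartialHomeomorph.symm (x, 0), e.proj_symm_apply' he⟩

theorem isCoveringMap (P : PrincipalBundle X) : IsCoveringMap P.proj := by
  choose e he _ using P.locally_trivial
  exact IsCoveringMap.mk P.proj (fun _ => ZMod 2) e he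

/-- The element of `ℤ/2` which moves `p` to `q`, for `p` and `q` in the same fibre. -/
noncomputable def diff (P : PrincipalBundle X) (p q : P.total) : ZMod 2 :=
  haveI := Classical.propDecidable (P.proj p = P.proj q)
  if h : P.proj p = P.proj q then (P.exists_vadd_eq h).choose else 0

theorem diff_vadd (P : PrincipalBundle X) {p q : P.total} (h : P.proj p = P.proj q) :
    P.diff p q +ᵥ p = q := by
  unfold diff
  rw [dif_pos h]
  exact (P.exists_vadd_eq h).choose_spec

theorem diff_eq_iff (P : PrincipalBundle X) {p q : P.total} (h : P.proj p = P.proj q)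
    {a : ZMod 2} : P.diff p q = a ↔ a +ᵥ p = q := by
  rw [← P.vadd_right_inj (p := p), P.diff_vadd h, eq_comm]

theorem diff_vadd_vadd (P : PrincipalBundle X) (a b : ZMod 2) {p q : P.total}
    (h : P.proj p = P.proj q) : P.diff (a +ᵥ p) (b +ᵥ q) = a + b + P.diff p q := by
  rw [P.diff_eq_iff (by rw [P.proj_vadd, P.proj_vadd, h])]
  conv_rhs => rw [← P.diff_vadd h]
  rw [← add_vadd, ← add_vadd]
  congr 1
  -- The two copies of `a` cancel in characteristic two, so no sign appears in the formula.
  linear_combination CharTwo.add_self_eq_zero a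

/-- The action is assumed continuous only for each fixed group element. Since `ZMod 2` is discrete,
`t` is constant near `y`, which is enough. -/
theorem continuousAt_vadd (P : PrincipalBundle X) {t : T → ZMod 2} {s : T → P.total} {y : T}
    (ht : ContinuousAt t y) (hs : ContinuousAt s y) : ContinuousAt (fun z => t z +ᵥ s z) y := by
  have h1 : ContinuousAt (fun z => t y +ᵥ s z) y :=
    (P.continuous_vadd (t y)).continuousAt.comp hs
  refine h1.congr ?_
  have h2 : t ⁻¹' {t y} ∈ 𝓝 y := ht.preimage_mem_nhds ((isOpen_discrete _).mem_nhds rfl)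
  filter_upwards [h2] with z hz
  rw [show t z = t y from hz]

/-- In an equivariant trivialization `diff` is the difference of the second coordinates. -/
theorem continuousAt_diff (P : PrincipalBundle X) {s t : T → P.total} {y : T}
    (hs : ContinuousAt s y) (ht : ContinuousAt t y) (h : ∀ᶠ z in 𝓝 y, P.proj (s z) = P.proj (t z)) :
    ContinuousAt (fun z => P.diff (s z) (t z)) y := by
  obtain ⟨e, he, hv⟩ := P.locally_trivial (P.proj (s y))
  have hes : s y ∈ e.source := e.mem_source.2 he
  have het : t y ∈ e.source := e.mem_source.2 (h.self_of_nhds ▸ he)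
  have hc : ContinuousAt (fun z => (e (t z)).2 - (e (s z)).2) y :=
    ((e.continuousAt het).comp ht).snd.sub ((e.continuousAt hes).comp hs).snd
  refine hc.congr ?_
  filter_upwards [h, hs.preimage_mem_nhds (e.open_source.mem_nhds hes)] with z hz hzs
  have hb : P.proj (s z) ∈ e.baseSet := e.mem_source.1 hzs
  rw [sub_eq_iff_eq_add, ← hv _ _ hb, P.diff_vadd hz]

theorem continuous_diff (P : PrincipalBundle X) {s t : T → P.total}
    (hs : Continuous s) (ht : Continuous t) (h : ∀ z, P.proj (s z) = P.proj (t z)) :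
    Continuous fun z => P.diff (s z) (t z) :=
  continuous_iff_continuousAt.2 fun _ => P.continuousAt_diff hs.continuousAt ht.continuousAt
    (Filter.Eventually.of_forall h)

/-- Local sections exist through every point. -/
theorem exists_local_section (P : PrincipalBundle X) (p : P.total) :
    ∃ (s : X → P.total) (U : Set X), IsOpen U ∧ P.proj p ∈ U ∧ s (P.proj p) = p ∧
      ∀ x ∈ U, ContinuousAt s x ∧ P.proj (s x) = x := by
  obtain ⟨e, he, hv⟩ := P.locally_trivial (P.proj p)
  refine ⟨fun x => e.toOpenPartialHomeomorph.symm (x, (e p).2), e.baseSet, e.open_baseSet, he,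
    e.symm_apply_mk_proj (e.mem_source.2 he), fun x hx => ⟨?_, e.proj_symm_apply' hx⟩⟩
  have : ContinuousAt e.toOpenPartialHomeomorph.symm (x, (e p).2) :=
    e.toOpenPartialHomeomorph.continuousAt_symm (e.mem_target.2 hx)
  exact ContinuousAt.comp (f := fun x => (x, (e p).2)) this (by fun_prop)

/-- A function on the total space is continuous if it is so along a local section. -/
theorem continuousAt_of_section (P : PrincipalBundle X) {p : P.total} {f : P.total → T}
    {s : X → P.total} (hs : ContinuousAt s (P.proj p)) (hp : s (P.proj p) = p)
    (hproj : ∀ᶠ x in 𝓝 (P.proj p), P.proj (s x) = x)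
    (hf : ContinuousAt (fun x => f (s x)) (P.proj p)) : ContinuousAt f p := by
  have hπ : ContinuousAt P.proj p := P.continuous_proj.continuousAt
  have h1 : ContinuousAt (fun q => f (s (P.proj q))) p := ContinuousAt.comp' (f := P.proj) hf hπ
  have h2 : ∀ᶠ q in 𝓝 p, P.proj (s (P.proj q)) = P.proj q := hπ.eventually hproj
  have h3 : ContinuousAt (fun q => P.diff (s (P.proj q)) q) p :=
    P.continuousAt_diff (ContinuousAt.comp' (f := P.proj) hs hπ) continuousAt_id h2
  refine h1.congr ?_
  -- The offset of `q` from the section is continuous with discrete values and is `0` at `p`, so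
  -- near `p` every `q` lies on the section.
  have h4 := h3.preimage_mem_nhds ((isOpen_discrete {(0 : ZMod 2)}).mem_nhds
    ((P.diff_eq_iff (by rw [hp])).2 (by rw [hp, zero_vadd])))
  filter_upwards [h2, h4] with q hq h0
  rw [mem_preimage, mem_singleton_iff, P.diff_eq_iff hq, zero_vadd] at h0
  simp only [h0]

/-! ### Isomorphisms -/

/-- A continuous equivariant map of principal bundles over `X` is an isomorphism. -/
noncomputable def Iso.ofMap {P Q : PrincipalBundle X} (f : P.total → Q.total) (hf : Continuous f)
    (hproj : ∀ p, Q.proj (f p) = P.proj p) (hv : ∀ (a : ZMod 2) (p), f (a +ᵥ p) = a +ᵥ f p) :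
    P.Iso Q where
  toHomeomorph := by
    refine IsLocalHomeomorph.toHomeomorphOfBijective (f := f) ?_ ⟨fun p q h => ?_, fun q => ?_⟩
    -- `Q.proj ∘ f = P.proj` and `Q.proj` are both local homeomorphisms, hence so is `f`.
    -- Bijectivity comes from the free transitive action on fibres.
    · refine IsLocalHomeomorph.of_comp (g := Q.proj) ?_ Q.isCoveringMap.isLocalHomeomorph hf
      rw [show Q.proj ∘ f = P.proj from funext hproj]
      exact P.isCoveringMap.isLocalHomeomorph
    · obtain ⟨a, rfl⟩ := P.exists_vadd_eq (p := p) (q := q) (by rw [← hproj, h, hproj])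
      rw [hv] at h
      have : (0 : ZMod 2) = a := Q.vadd_right_inj.1 ((zero_vadd _ _).trans h)
      rw [← this, zero_vadd]
    · obtain ⟨p, hp⟩ := P.proj_surjective (Q.proj q)
      obtain ⟨a, rfl⟩ := Q.exists_vadd_eq (p := f p) (q := q) (by rw [hproj, hp])
      exact ⟨a +ᵥ p, hv _ _⟩
  proj_eq := hproj
  map_vadd := hv

/-- A point of a pullback. -/
def pullbackMk (P : PrincipalBundle X) (g : C(Y, X)) (y : Y) (p : P.total) (h : g y = P.proj p) :
    (P.pullback g).total := ⟨(y, p), h⟩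

theorem vadd_pullbackMk (P : PrincipalBundle X) (g : C(Y, X)) (a : ZMod 2) (y : Y) (p : P.total)
    (h : g y = P.proj p) : a +ᵥ P.pullbackMk g y p h =
      P.pullbackMk g y (a +ᵥ p) (h.trans (P.proj_vadd a p).symm) := rfl

/-- A principal bundle with a bundle map to `P` is a pullback of `P`. -/
noncomputable def Iso.toPullback {Q : PrincipalBundle Y} {P : PrincipalBundle X} (g : C(Y, X))
    (f : Q.total → P.total) (hf : Continuous f) (hproj : ∀ q, P.proj (f q) = g (Q.proj q))
    (hv : ∀ (a : ZMod 2) (q), f (a +ᵥ q) = a +ᵥ f q) : Q.Iso (P.pullback g) :=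
  Iso.ofMap (fun q => ⟨(Q.proj q, f q), (hproj q).symm⟩)
    ((Q.continuous_proj.prodMk hf).subtype_mk _) (fun _ => rfl)
    (fun a q => Subtype.ext (Prod.ext (Q.proj_vadd a q) (hv a q)))

theorem continuous_pullback_snd (P : PrincipalBundle X) (g : C(Y, X)) :
    Continuous fun q : (P.pullback g).total => q.1.2 :=
  continuous_snd.comp continuous_subtype_val

noncomputable def pullbackId (P : PrincipalBundle X) : P.Iso (P.pullback (ContinuousMap.id X)) :=
  Iso.toPullback _ id continuous_id (fun _ => rfl) fun _ _ => rfl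

noncomputable def pullbackComp (P : PrincipalBundle X) (g : C(Y, X)) (k : C(Z, Y)) :
    ((P.pullback g).pullback k).Iso (P.pullback (g.comp k)) :=
  Iso.toPullback _ (fun q => q.1.2.1.2)
    ((P.continuous_pullback_snd g).comp ((P.pullback g).continuous_pullback_snd k))
    (fun q => by
      rw [← q.1.2.2]
      exact congrArg g q.2.symm) fun _ _ => rfl

/-- The automorphisms of a principal bundle are the locally constant functions to `ℤ/2`. -/
theorem card_iso_self (P : PrincipalBundle X) : Nat.card (P.Iso P) = Nat.card C(X, ZMod 2) := by
  refine (Nat.card_congr (Equiv.ofBijective (fun t : C(X, ZMod 2) => (Iso.ofMap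
    (fun p => t (P.proj p) +ᵥ p) (continuous_iff_continuousAt.2 fun p =>
      P.continuousAt_vadd (t.continuous.comp P.continuous_proj).continuousAt continuousAt_id)
    (fun p => P.proj_vadd _ _) fun a p => by
      rw [P.proj_vadd, ← add_vadd, ← add_vadd, add_comm] : P.Iso P)) ⟨?_, ?_⟩)).symm
  · intro t t' h
    ext x
    obtain ⟨p, rfl⟩ := P.proj_surjective x
    exact P.vadd_right_inj.1 (congrArg (fun φ : P.Iso P => φ.toHomeomorph p) h)
  · intro φ
    choose s hs using P.proj_surjective
    -- The offset of `φ` depends only on the base point, since moving `p` and `φ p` by the same `a`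
    -- changes nothing. The discontinuity of the chosen `s` is therefore harmless, and continuity
    -- can be tested on the total space.
    have hd : ∀ p, P.diff p (φ.toHomeomorph p) =
        P.diff (s (P.proj p)) (φ.toHomeomorph (s (P.proj p))) := by
      intro p
      obtain ⟨a, ha⟩ := P.exists_vadd_eq (hs (P.proj p))
      conv_lhs => rw [← ha, φ.map_vadd]
      rw [P.diff_vadd_vadd _ _ (φ.proj_eq _).symm, CharTwo.add_self_eq_zero, zero_add]
    refine ⟨⟨fun x => P.diff (s x) (φ.toHomeomorph (s x)), ?_⟩, Iso.ext fun p => ?_⟩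
    · rw [(P.isCoveringMap.isQuotientMap P.proj_surjective).continuous_iff]
      refine (P.continuous_diff continuous_id φ.toHomeomorph.continuous
        fun p => (φ.proj_eq p).symm).congr hd
    · change P.diff (s (P.proj p)) (φ.toHomeomorph (s (P.proj p))) +ᵥ p = _
      rw [← hd, P.diff_vadd (φ.proj_eq p).symm]

end PrincipalBundle

/-! ### Isomorphism classes of bundles and their automorphism counts. -/

namespace BunClass

variable {X Y Z : Type u} [TopologicalSpace X] [TopologicalSpace Y] [TopologicalSpace Z]

theorem mk_eq_mk {P Q : PrincipalBundle X} : mk P = mk Q ↔ Nonempty (P.Iso Q) :=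
  Quotient.eq

theorem exists_rep (Q : BunClass X) : ∃ P, mk P = Q := Quotient.exists_rep Q

theorem pullback_id (Q : BunClass X) : Q.pullback (ContinuousMap.id X) = Q := by
  obtain ⟨P, rfl⟩ := Q.exists_rep
  exact (mk_eq_mk.2 ⟨P.pullbackId⟩).symm

theorem pullback_pullback (Q : BunClass X) (g : C(Y, X)) (k : C(Z, Y)) :
    (Q.pullback g).pullback k = Q.pullback (g.comp k) := by
  obtain ⟨P, rfl⟩ := Q.exists_rep
  exact mk_eq_mk.2 ⟨P.pullbackComp g k⟩

/-- The count is the same for all classes on `X`; this is what makes the weights in the push-pull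
map computable. -/
theorem autCard_eq (Q : BunClass X) : Q.autCard = Nat.card C(X, ZMod 2) := by
  obtain ⟨P, rfl⟩ := Q.exists_rep
  exact P.card_iso_self

end BunClass

/-! ### Bundles on cylinders and homotopy invariance. -/

open scoped unitInterval

namespace PrincipalBundle

variable {X Y N : Type u} [TopologicalSpace X] [TopologicalSpace Y] [TopologicalSpace N]

/-- The inclusion of `{t} × N` in the cylinder `[0, 1] × N`. -/
def cylinderIncl (N : Type u) [TopologicalSpace N] (t : I) : C(N, I × N) :=
  ⟨fun x => (t, x), continuous_const.prodMk continuous_id⟩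

/-- Homotopy invariance: a bundle on `[0, 1] × N` is pulled back from its restriction to
`{0} × N`. -/
theorem nonempty_iso_cylinder (P : PrincipalBundle (I × N)) :
    Nonempty (((P.pullback (cylinderIncl N 0)).pullback ContinuousMap.snd).Iso P) := by
  set P₀ := P.pullback (cylinderIncl N 0)
  let H : C(I × P₀.total, I × N) :=
    ⟨fun z => (z.1, P₀.proj z.2), continuous_fst.prodMk (P₀.continuous_proj.comp continuous_snd)⟩
  let f : C(P₀.total, P.total) := ⟨fun q => q.1.2, P.continuous_pullback_snd _⟩
  have H0 : ∀ q, H (0, q) = P.proj (f q) := fun q => q.2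
  -- The tautological bundle map `f` covers `{0} × N`; lifting the homotopy `H` extends it along the
  -- interval.
  let L := P.isCoveringMap.liftHomotopy H f H0
  have hL : ∀ z, P.proj (L z) = H z := congr_fun (P.isCoveringMap.liftHomotopy_lifts H f H0)
  have hL0 : ∀ q, L (0, q) = f q := P.isCoveringMap.liftHomotopy_zero H f H0
  have hv : ∀ (a : ZMod 2) (t : I) (q : P₀.total), L (t, a +ᵥ q) = a +ᵥ L (t, q) := by
    intro a t q
    -- Equivariance follows from uniqueness of lifts: the conjugate of `L` by `a` lifts `H` too,
    -- with the same start because `a + a = 0`.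
    have h : (fun z : I × P₀.total => a +ᵥ L (z.1, a +ᵥ z.2)) = L := by
      refine (P.isCoveringMap.eq_liftHomotopy_iff H0 _).2 ⟨fun q => ?_, ?_, fun q => ?_⟩
      · exact (P.continuous_vadd a).comp (L.continuous.comp
          ((continuous_id.prodMk continuous_const : Continuous fun t : I => (t, a +ᵥ q))))
      · funext z
        change P.proj (a +ᵥ L (z.1, a +ᵥ z.2)) = _
        rw [P.proj_vadd, hL]
        exact Prod.ext rfl (P₀.proj_vadd a z.2)
      · change a +ᵥ L (0, a +ᵥ q) = _
        rw [hL0]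
        exact P.vadd_add_cancel a _
    rw [← congr_fun h (t, q)]
    exact (P.vadd_add_cancel a _).symm
  refine ⟨Iso.ofMap (fun q => L (q.1.1.1, q.1.2)) ?_ (fun q => ?_) fun a q => hv a _ _⟩
  · exact L.continuous.comp ((continuous_fst.comp (continuous_fst.comp
      continuous_subtype_val)).prodMk (P₀.continuous_pullback_snd _))
  · exact (hL _).trans (Prod.ext rfl q.2.symm)

/-- A bundle over the target of a null-homotopic map has a lift. -/
theorem exists_lift_of_nullhomotopic {D : Type*} [TopologicalSpace D] (P : PrincipalBundle X)
    (H : C(I × D, X)) (x : X) (h0 : ∀ z, H (0, z) = x) :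
    ∃ s : C(D, P.total), ∀ z, P.proj (s z) = H (1, z) := by
  obtain ⟨p, rfl⟩ := P.proj_surjective x
  let L := P.isCoveringMap.liftHomotopy H (.const D p) h0
  have hL : ∀ z, P.proj (L z) = H z := congr_fun (P.isCoveringMap.liftHomotopy_lifts H _ h0)
  exact ⟨⟨fun z => L (1, z), L.continuous.comp (continuous_const.prodMk continuous_id)⟩,
    fun z => hL _⟩

end PrincipalBundle

namespace BunClass

open PrincipalBundle (cylinderIncl)

variable {X Y N : Type u} [TopologicalSpace X] [TopologicalSpace Y] [TopologicalSpace N]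

theorem pullback_snd_cylinderIncl (Q : BunClass N) (t : I) :
    (Q.pullback (ContinuousMap.snd : C(I × N, N))).pullback (cylinderIncl N t) = Q := by
  rw [pullback_pullback]
  exact Q.pullback_id

theorem pullback_cylinderIncl_zero (P : BunClass (I × N)) :
    (P.pullback (cylinderIncl N 0)).pullback ContinuousMap.snd = P := by
  obtain ⟨P, rfl⟩ := P.exists_rep
  exact mk_eq_mk.2 P.nonempty_iso_cylinder

/-- Since `P` is pulled back from `N`, its restrictions to all slices agree. -/
theorem pullback_cylinderIncl (P : BunClass (I × N)) (t : I) :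
    (P.pullback (cylinderIncl N t)).pullback ContinuousMap.snd = P := by
  conv_rhs => rw [← P.pullback_cylinderIncl_zero]
  congr 1
  conv_lhs => rw [← P.pullback_cylinderIncl_zero]
  rw [pullback_snd_cylinderIncl]

/-- Homotopic maps induce the same pullback. -/
theorem pullback_eq_of_homotopy (Q : BunClass X) (F : C(I × Y, X)) :
    Q.pullback (F.comp (cylinderIncl Y 0)) = Q.pullback (F.comp (cylinderIncl Y 1)) := by
  rw [← pullback_pullback, ← pullback_pullback,
    ← (Q.pullback F).pullback_cylinderIncl_zero, pullback_snd_cylinderIncl,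
    pullback_snd_cylinderIncl]

end BunClass

/-- A locally constant function factors through the set of components, which is finite here. This
keeps the automorphism counts, taken with `Nat.card`, nonzero as denominators. -/
theorem finite_continuousMap_zmod_two (N : Type*) [TopologicalSpace N] [CompactSpace N]
    [LocallyConnectedSpace N] : Finite C(N, ZMod 2) := by
  refine Finite.of_injective (fun (t : C(N, ZMod 2)) (c : ConnectedComponents N) =>
    t.continuous.connectedComponentsLift c) fun t t' h => ?_
  ext x
  exact congr_fun h (x : ConnectedComponents N)

/-- Connectedness of the interval makes each function constant along it, so restriction to `{0} × N`
is a bijection. -/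
theorem card_continuousMap_cylinder (N : Type*) [TopologicalSpace N] :
    Nat.card C(I × N, ZMod 2) = Nat.card C(N, ZMod 2) := by
  refine Nat.card_congr (Equiv.ofBijective
    (fun t => t.comp ⟨fun x => (0, x), continuous_const.prodMk continuous_id⟩) ⟨?_, ?_⟩)
  · intro t t' h
    ext ⟨r, x⟩
    have hc : ∀ t : C(I × N, ZMod 2), t (r, x) = t (0, x) := fun t =>
      PreconnectedSpace.constant inferInstance (f := fun r => t (r, x))
        (t.continuous.comp (continuous_id.prodMk continuous_const))
    rw [hc, hc]
    exact congr_arg (fun s : C(N, ZMod 2) => s x) h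
  · exact fun t => ⟨t.comp ContinuousMap.snd, rfl⟩

/-! ### Mapping cylinders in Dijkgraaf-Witten theory. -/

namespace DW₀

open PrincipalBundle (cylinderIncl)

variable {N : Type u} [TopologicalSpace N]

/-- The mapping cylinder of `f` acts by pullback along `f`. -/
theorem mappingCylinder_apply [CompactSpace N] [LocallyConnectedSpace N] (f : N ≃ₜ N) (Ψ : DW₀ N)
    (Q : BunClass N) : mappingCylinder f Ψ Q = Ψ (Q.pullback ⟨f, f.continuous⟩) := by
  have := finite_continuousMap_zmod_two N
  have hcard : (Nat.card C(N, ZMod 2) : ℂ) ≠ 0 := Nat.cast_ne_zero.2 Nat.card_pos.ne'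
  let F : C(N, N) := ⟨f, f.continuous⟩
  let G : C(N, N) := ⟨f.symm, f.symm.continuous⟩
  have hFG : F.comp G = ContinuousMap.id N := ContinuousMap.ext f.apply_symm_apply
  have hGF : G.comp F = ContinuousMap.id N := ContinuousMap.ext f.symm_apply_apply
  have hi' : ∀ P : BunClass (I × N), P.pullback
      ⟨fun x => (1, f.symm x), continuous_const.prodMk f.symm.continuous⟩ =
      (P.pullback (cylinderIncl N 1)).pullback G := fun P =>
    (P.pullback_pullback (cylinderIncl N 1) G).symm
  -- Exactly one class on the cylinder restricts to `Q` on the outgoing boundary.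
  have hkey : ∀ P : BunClass (I × N), (P.pullback (cylinderIncl N 1)).pullback G = Q ↔
      P = (Q.pullback F).pullback ContinuousMap.snd := by
    intro P
    constructor
    · rintro rfl
      rw [BunClass.pullback_pullback _ G F, hGF, BunClass.pullback_id,
        BunClass.pullback_cylinderIncl]
    · rintro rfl
      rw [BunClass.pullback_snd_cylinderIncl, BunClass.pullback_pullback, hFG,
        BunClass.pullback_id]
  unfold mappingCylinder bordism
  let P₁ : BunClass (I × N) := (Q.pullback F).pullback ContinuousMap.snd
  -- Only `P₁` contributes, so no finiteness of the set of classes is needed.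
  refine (finsum_eq_single _ P₁ fun P hP => if_neg fun h =>
    hP ((hkey P).1 ((hi' P).symm.trans h))).trans ?_
  rw [if_pos ((hi' P₁).trans ((hkey P₁).2 rfl)), BunClass.autCard_eq, BunClass.autCard_eq,
    card_continuousMap_cylinder, div_self hcard, one_mul]
  exact congrArg Ψ ((Q.pullback F).pullback_snd_cylinderIncl 0)

end DW₀

/-! ### The action of the mapping class group -/

section MappingClassGroup

variable {d : ℕ} {M : Type u} [TopologicalSpace M] [ChartedSpace (EuclideanSpace ℝ (Fin d)) M]

/-- The action of diffeomorphisms on functions on `π₀ Bun(M)`. -/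
noncomputable def diffRepresentation (d : ℕ) (M : Type u) [TopologicalSpace M]
    [ChartedSpace (EuclideanSpace ℝ (Fin d)) M] : Representation ℂ (Diff d M) (DW₀ M) where
  toFun f := LinearMap.funLeft ℂ ℂ (BunClass.pullback ⟨f, f.continuous⟩)
  map_one' := LinearMap.ext fun Ψ => funext fun Q => congrArg Ψ Q.pullback_id
  -- Pullback reverses composition, and passing to functions reverses it again: a left action
  -- results.
  map_mul' f g := LinearMap.ext fun Ψ => funext fun Q => congrArg Ψ
    (Q.pullback_pullback ⟨f, f.continuous⟩ ⟨g, g.continuous⟩).symm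

/-- An isotopy restricted to `[0, 1]` is a homotopy from the identity to `f`, and homotopic maps
have equal pullbacks. -/
theorem pullback_isotopicToId {f : Diff d M} (hf : f ∈ Diff.isotopicToId d M) (Q : BunClass M) :
    Q.pullback ⟨f, f.continuous⟩ = Q := by
  obtain ⟨F, hF0, rfl, hF⟩ := hf
  let G : C(I × M, M) := ⟨fun z => F z.1 z.2, hF.continuous.comp
    ((continuous_subtype_val.comp continuous_fst).prodMk continuous_snd)⟩
  have h0 : G.comp (PrincipalBundle.cylinderIncl M 0) = ContinuousMap.id M :=
    ContinuousMap.ext fun x => congrArg (fun φ : Diff d M => φ x) hF0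
  refine Eq.trans (Q.pullback_eq_of_homotopy G).symm ?_
  rw [h0, Q.pullback_id]

/-- The action of the mapping class group on functions on `π₀ Bun(M)`. -/
noncomputable def mcgRepresentation (d : ℕ) (M : Type u) [TopologicalSpace M]
    [ChartedSpace (EuclideanSpace ℝ (Fin d)) M] : Representation ℂ (MCG d M) (DW₀ M) :=
  QuotientGroup.lift _ (diffRepresentation d M) fun _ hf => LinearMap.ext fun Ψ =>
    funext fun Q => congrArg Ψ (pullback_isotopicToId hf Q)

end MappingClassGroup

/-! ### Gluing -/

/-- For a closed map, an open set containing the fibre over `x` contains the preimage of a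
neighbourhood of `x`. The pointwise form is needed because it will be applied to sections that are
continuous only locally. -/
theorem continuousAt_of_isClosedMap_cover {A D X T : Type*} [TopologicalSpace A]
    [TopologicalSpace D] [TopologicalSpace X] [TopologicalSpace T] {j : A → X} {g : D → X}
    (hj : IsClosedMap j) (hg : IsClosedMap g) (hcover : ∀ x, (∃ a, j a = x) ∨ ∃ z, g z = x)
    {f : X → T} {x : X} (hA : ∀ a, j a = x → ContinuousAt (f ∘ j) a)
    (hD : ∀ z, g z = x → ContinuousAt (f ∘ g) z) : ContinuousAt f x := by
  refine fun W hW => Filter.mem_map.2 ?_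
  have h1 : ∀ᶠ y in 𝓝 x, ∀ a ∈ j ⁻¹' {y}, f (j a) ∈ W := by
    refine hj.eventually_nhds_fiber x fun a ha => ?_
    obtain rfl : j a = x := ha
    exact hA a rfl hW
  have h2 : ∀ᶠ y in 𝓝 x, ∀ z ∈ g ⁻¹' {y}, f (g z) ∈ W := by
    refine hg.eventually_nhds_fiber x fun z hz => ?_
    obtain rfl : g z = x := hz
    exact hD z rfl hW
  filter_upwards [h1, h2] with y hy1 hy2
  rcases hcover y with ⟨a, rfl⟩ | ⟨z, rfl⟩
  · exact hy1 a rfl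
  · exact hy2 z rfl

/-- A space `X` obtained from a subspace `A` by attaching a space `D` along a map `b : S → A`
defined on a closed subspace `S` of `D`. -/
structure Attachment (A X : Type u) (D : Type*) [TopologicalSpace A] [TopologicalSpace X]
    [TopologicalSpace D] where
  incl : C(A, X)
  char : C(D, X)
  bdry : Set D
  attach : C(bdry, A)
  incl_injective : Function.Injective incl
  isClosed_bdry : IsClosed bdry
  incl_attach : ∀ z : bdry, incl (attach z) = char z
  char_injOn : InjOn char bdryᶜ
  char_ne_incl : ∀ z ∉ bdry, ∀ a, incl a ≠ char z
  cover : ∀ x, (∃ a, incl a = x) ∨ ∃ z, char z = x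

namespace PrincipalBundle

variable {A X : Type u} {D : Type*} [TopologicalSpace A] [TopologicalSpace X] [TopologicalSpace D]

/-- Isomorphisms extend over attached spaces. -/
theorem nonempty_iso_of_attachment [CompactSpace A] [CompactSpace D] [T2Space X]
    (𝔞 : Attachment A X D) {P Q : PrincipalBundle X}
    (φ : (P.pullback 𝔞.incl).Iso (Q.pullback 𝔞.incl)) (p : C(D, P.total)) (q : C(D, Q.total))
    (hp : ∀ z, P.proj (p z) = 𝔞.char z) (hq : ∀ z, Q.proj (q z) = 𝔞.char z) (ε : C(D, ZMod 2))
    (hε : ∀ z : 𝔞.bdry, (φ.toHomeomorph (P.pullbackMk _ (𝔞.attach z) (p z)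
      ((𝔞.incl_attach z).trans (hp z).symm))).1.2 = ε z +ᵥ q z) : Nonempty (P.Iso Q) := by
  have hφ : ∀ r, Q.proj (φ.toHomeomorph r).1.2 = P.proj r.1.2 := fun r => by
    rw [← (φ.toHomeomorph r).2, ← r.2]
    exact congrArg 𝔞.incl (φ.proj_eq r)
  -- The value on `r` is prescribed by `φ` over `A` and by `p ↦ ε + q`, extended equivariantly, over
  -- `D`. Both prescriptions are demanded at once; they agree on the overlap by `hε`.
  have key : ∀ r : P.total, ∃ s : Q.total,
      (∀ a (h : 𝔞.incl a = P.proj r), s = (φ.toHomeomorph (P.pullbackMk _ a r h)).1.2) ∧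
      ∀ z, 𝔞.char z = P.proj r → s = (P.diff (p z) r + ε z) +ᵥ q z := by
    intro r
    by_cases hA : ∃ a, 𝔞.incl a = P.proj r
    · obtain ⟨a, ha⟩ := hA
      refine ⟨(φ.toHomeomorph (P.pullbackMk _ a r ha)).1.2, fun a' ha' => ?_, fun z hz => ?_⟩
      · obtain rfl : a = a' := 𝔞.incl_injective (ha.trans ha'.symm)
        rfl
      · have hzS : z ∈ 𝔞.bdry := by
          by_contra hzS
          exact 𝔞.char_ne_incl z hzS a (ha.trans hz.symm)
        have hza : 𝔞.attach ⟨z, hzS⟩ = a :=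
          𝔞.incl_injective ((𝔞.incl_attach _).trans (hz.trans ha.symm))
        subst hza
        have h1 : P.diff (p z) r +ᵥ p z = r := P.diff_vadd (by rw [hp, hz])
        have h2 : P.pullbackMk 𝔞.incl (𝔞.attach ⟨z, hzS⟩) r ha = P.diff (p z) r +ᵥ
            P.pullbackMk _ (𝔞.attach ⟨z, hzS⟩) (p z) ((𝔞.incl_attach _).trans (hp z).symm) :=
          Subtype.ext (Prod.ext rfl h1.symm)
        rw [h2, φ.map_vadd, add_vadd, ← hε ⟨z, hzS⟩]
        rfl
    · rcases 𝔞.cover (P.proj r) with h | ⟨z, hz⟩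
      · exact absurd h hA
      · refine ⟨(P.diff (p z) r + ε z) +ᵥ q z, fun a ha => absurd ⟨a, ha⟩ hA, fun z' hz' => ?_⟩
        have hS : ∀ w, 𝔞.char w = P.proj r → w ∈ 𝔞.bdryᶜ := fun w hw hwS =>
          hA ⟨_, (𝔞.incl_attach ⟨w, hwS⟩).trans hw⟩
        rw [𝔞.char_injOn (hS z hz) (hS z' hz') (hz.trans hz'.symm)]
  choose f hfA hfD using key
  have hproj : ∀ r, Q.proj (f r) = P.proj r := by
    intro r
    rcases 𝔞.cover (P.proj r) with ⟨a, ha⟩ | ⟨z, hz⟩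
    · rw [hfA r a ha]
      exact hφ _
    · rw [hfD r z hz, Q.proj_vadd, hq, hz]
  refine ⟨Iso.ofMap f ?_ hproj fun c r => ?_⟩
  -- Along a local section `s` of `P` the question becomes one on the base, where it is tested
  -- separately after `incl` and after `char`.
  · refine continuous_iff_continuousAt.2 fun r => ?_
    obtain ⟨s, U, hU, hrU, hsr, hs⟩ := P.exists_local_section r
    refine P.continuousAt_of_section (hs _ hrU).1 hsr
      (Filter.eventually_of_mem (hU.mem_nhds hrU) fun x hx => (hs x hx).2) ?_
    refine continuousAt_of_isClosedMap_cover 𝔞.incl.continuous.isClosedMap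
      𝔞.char.continuous.isClosedMap 𝔞.cover (fun a ha => ?_) fun z hz => ?_
    · have hO : IsOpen (𝔞.incl ⁻¹' U) := hU.preimage 𝔞.incl.continuous
      have haU : a ∈ 𝔞.incl ⁻¹' U := by rw [mem_preimage, ha]; exact hrU
      refine ContinuousOn.continuousAt ?_ (hO.mem_nhds haU)
      rw [continuousOn_iff_continuous_domRestrict]
      have hsec : Continuous fun b : 𝔞.incl ⁻¹' U => s (𝔞.incl b) :=
        continuous_iff_continuousAt.2 fun b => ContinuousAt.comp'
          (f := fun b : 𝔞.incl ⁻¹' U => 𝔞.incl b.1)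
          (hs _ b.2).1 (𝔞.incl.continuous.comp continuous_subtype_val).continuousAt
      have hlift : Continuous fun b : 𝔞.incl ⁻¹' U =>
          P.pullbackMk 𝔞.incl b.1 (s (𝔞.incl b)) (hs _ b.2).2.symm :=
        (continuous_subtype_val.prodMk hsec).subtype_mk _
      refine ((Q.continuous_pullback_snd _).comp (φ.toHomeomorph.continuous.comp hlift)).congr
        fun b => ?_
      exact (hfA _ b.1 (hs _ b.2).2.symm).symm
    · have hzU : 𝔞.char z ∈ U := by rw [hz]; exact hrU
      have hev : ∀ᶠ w in 𝓝 z, 𝔞.char w ∈ U :=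
        𝔞.char.continuous.continuousAt.preimage_mem_nhds (hU.mem_nhds hzU)
      have hc1 : ContinuousAt (fun w => s (𝔞.char w)) z :=
        ContinuousAt.comp' (f := 𝔞.char) (hs _ hzU).1 𝔞.char.continuous.continuousAt
      have hc2 : ContinuousAt (fun w => P.diff (p w) (s (𝔞.char w))) z :=
        P.continuousAt_diff p.continuous.continuousAt hc1 <| by
          filter_upwards [hev] with w hw
          rw [hp, (hs _ hw).2]
      refine (Q.continuousAt_vadd (hc2.add ε.continuous.continuousAt)
        q.continuous.continuousAt).congr ?_
      filter_upwards [hev] with w hw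
      exact (hfD _ w (hs _ hw).2.symm).symm
  · rcases 𝔞.cover (P.proj r) with ⟨a, ha⟩ | ⟨z, hz⟩
    · rw [hfA r a ha, hfA (c +ᵥ r) a (by rw [P.proj_vadd, ha])]
      rw [← P.vadd_pullbackMk, φ.map_vadd]
      rfl
    · rw [hfD r z hz, hfD (c +ᵥ r) z (by rw [P.proj_vadd, hz]), ← add_vadd, ← add_assoc]
      congr 2
      have := P.diff_vadd_vadd 0 c (p := p z) (q := r) (by rw [hp, hz])
      rwa [zero_vadd, zero_add] at this

/-- A principal bundle is glued from trivial bundles on the members of an open cover, the local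
sections being described by their difference from a discontinuous global section. -/
theorem exists_bundle_of_local_sections {ι : Type*} (U : ι → Set X) (hU : ∀ i, IsOpen (U i))
    (hcover : ∀ x, ∃ i, x ∈ U i) (h : ι → X → ZMod 2)
    (hc : ∀ i j, ∀ x ∈ U i ∩ U j, ContinuousAt (fun y => h i y - h j y) x) :
    ∃ (Q : PrincipalBundle X) (c : X → Q.total), (∀ x, Q.proj (c x) = x) ∧
      ∀ i, ∀ x ∈ U i, ContinuousAt (fun y => h i y +ᵥ c y) x := by
  choose ind hind using hcover
  let Z : FiberBundleCore ι X (ZMod 2) :=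
    { baseSet := U
      isOpen_baseSet := hU
      indexAt := ind
      mem_baseSet_at := hind
      -- If `v` is the coordinate relative to the section `h i + c`, then relative to `h j + c` it
      -- is `v + (h i - h j)`.
      coordChange := fun i j x v => v + (h i x - h j x)
      coordChange_self := fun i x _ v => by rw [sub_self, add_zero]
      continuousOn_coordChange := fun i j => by
        rintro ⟨x, v⟩ hx
        have h1 : ContinuousAt (fun p : X × ZMod 2 => h i p.1 - h j p.1) (x, v) :=
          (hc i j x hx.1).comp' (g := fun y => h i y - h j y) (f := Prod.fst)
            (x := (x, v)) continuousAt_fst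
        exact (continuousAt_snd.add h1).continuousWithinAt
      coordChange_comp := fun i j k x _ v => by ring }
  let : ∀ x, AddCommGroup (Z.Fiber x) := fun x => inferInstanceAs (AddCommGroup (ZMod 2))
  let act : AddAction (ZMod 2) Z.TotalSpace :=
    { vadd := fun a p => ⟨p.1, (a + (show ZMod 2 from p.2) : ZMod 2)⟩
      zero_vadd := fun p => congrArg (TotalSpace.mk p.1) (zero_add (show ZMod 2 from p.2))
      add_vadd := fun a b p => congrArg (TotalSpace.mk p.1) (add_assoc a b (show ZMod 2 from p.2)) }
  have hact : ∀ (a : ZMod 2) (p : Z.TotalSpace) (i : ι),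
      (Z.localTriv i (a +ᵥ p)).2 = a + (Z.localTriv i p).2 := fun a p i => add_assoc _ _ _
  refine ⟨{ total := Z.TotalSpace
            proj := Z.proj
            continuous_vadd := fun a => continuous_iff_continuousAt.2 fun p => ?_
            proj_vadd := fun a p => rfl
            locally_trivial := fun x => ⟨Z.localTriv (ind x), hind x, fun a p _ => hact a p _⟩ },
    -- With this choice `c` has coordinate `-h i` in every chart `i`, so `h i + c` is the zero
    -- section of that chart.
    fun x => ⟨x, (-h (ind x) x : ZMod 2)⟩, fun x => rfl, fun i x hx => ?_⟩
  · have hp : a +ᵥ p ∈ (Z.localTriv (ind p.1)).source := hind p.1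
    refine ((Z.localTriv (ind p.1)).toOpenPartialHomeomorph.continuousAt_iff_continuousAt_comp_left
      (f := fun p : Z.TotalSpace => a +ᵥ p) ?_).2 ?_
    · exact Z.continuous_proj.continuousAt.preimage_mem_nhds
        ((hU _).mem_nhds (hind p.1))
    · have h1 : ContinuousAt (Z.localTriv (ind p.1)) p := (Z.localTriv (ind p.1)).continuousAt hp
      refine (h1.fst.prodMk ((continuousAt_const (y := a)).add h1.snd)).congr ?_
      exact Filter.Eventually.of_forall fun q => Prod.ext rfl (hact a q _).symm
  · have h1 : ContinuousAt (Z.localTriv i).toOpenPartialHomeomorph.symm (x, 0) :=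
      (Z.localTriv i).toOpenPartialHomeomorph.continuousAt_symm ((Z.localTriv i).mem_target.2 hx)
    refine (ContinuousAt.comp (f := fun x => (x, (0 : ZMod 2))) h1 (by fun_prop)).congr ?_
    refine Filter.Eventually.of_forall fun y => congrArg (TotalSpace.mk y) ?_
    change 0 + (h i y - h (ind y) y) = h i y + -h (ind y) y
    ring

theorem indicator_continuousAt {D : Type*} [TopologicalSpace D] {V₀ V₁ : Set D} (h₀ : IsOpen V₀)
    (h₁ : IsOpen V₁) (hd : Disjoint V₀ V₁) {z : D} (hz : z ∈ V₀ ∪ V₁) :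
    ContinuousAt (V₁.indicator (1 : D → ZMod 2)) z := by
  rcases hz with hz | hz
  · refine (continuousAt_const (y := (0 : ZMod 2))).congr ?_
    filter_upwards [h₀.mem_nhds hz] with w hw
    exact (indicator_of_notMem (Set.disjoint_left.1 hd hw) _).symm
  · refine (continuousAt_const (y := (1 : ZMod 2))).congr ?_
    filter_upwards [h₁.mem_nhds hz] with w hw
    exact (indicator_of_mem hw (1 : D → ZMod 2)).symm

/-- A bundle on `A` which is trivial along the attaching map extends to `X`. -/
theorem exists_extension_of_attachment [CompactSpace A] [CompactSpace D] [T2Space D] [T2Space X]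
    (𝔞 : Attachment A X D) (P : PrincipalBundle A) (τ : C(𝔞.bdry, P.total))
    (hτ : ∀ z, P.proj (τ z) = 𝔞.attach z) :
    ∃ Q : PrincipalBundle X, Nonempty ((Q.pullback 𝔞.incl).Iso P) := by
  classical
  have : T2Space A := .of_injective_continuous 𝔞.incl_injective 𝔞.incl.continuous
  -- An arbitrary, discontinuous section, relative to which all local sections are recorded.
  choose s₀ hs₀ using P.proj_surjective
  -- On the boundary `r` is the offset from `τ` to `s₀`; off the boundary the reference section is
  -- the trivialization over the cell, so the offset is `0`. Thus `h ∘ char + r` is the local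
  -- section `h` read in the trivialization over `D`.
  let r : D → ZMod 2 := fun z =>
    if hz : z ∈ 𝔞.bdry then P.diff (τ ⟨z, hz⟩) (s₀ (𝔞.attach ⟨z, hz⟩)) else 0
  have hr : ∀ z : 𝔞.bdry, r z = P.diff (τ z) (s₀ (𝔞.attach z)) := fun z => dif_pos z.2
  have hr0 : ∀ z ∉ 𝔞.bdry, r z = 0 := fun z hz => dif_neg hz
  -- The charts are all pairs of an open set and a local section that is continuous on both `A` and
  -- `D`. Continuity of the transition functions is then automatic, and only covering needs proof.
  let ι := {Uh : Set X × (X → ZMod 2) // IsOpen Uh.1 ∧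
    (∀ a, 𝔞.incl a ∈ Uh.1 → ContinuousAt (fun a => Uh.2 (𝔞.incl a) +ᵥ s₀ a) a) ∧
    ∀ z, 𝔞.char z ∈ Uh.1 → ContinuousAt (fun z => Uh.2 (𝔞.char z) + r z) z}
  have hcover : ∀ x, ∃ i : ι, x ∈ i.1.1 := by
    intro x
    by_cases hx : ∃ a, 𝔞.incl a = x
    · obtain ⟨a₀, rfl⟩ := hx
      obtain ⟨s, V, hV, haV, -, hs⟩ := P.exists_local_section (s₀ a₀)
      rw [hs₀] at haV
      obtain ⟨C, hC, hCc, hCV⟩ := exists_mem_nhds_isClosed_subset (hV.mem_nhds haV)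
      -- The section `s` near `a₀`, read relative to `τ` on the boundary, must be continued into
      -- `D`. Over the closed neighbourhood `C` its two level sets are closed and disjoint in the
      -- compact Hausdorff space `D`; separating them by `V₀` and `V₁` makes the indicator of `V₁` a
      -- continuation.
      let ε : 𝔞.bdry → ZMod 2 := fun z => P.diff (τ z) (s (𝔞.attach z))
      have hε : ∀ z, 𝔞.attach z ∈ C → ContinuousAt ε z := by
        intro z hz
        refine P.continuousAt_diff τ.continuous.continuousAt ?_ ?_
        · exact ContinuousAt.comp' (f := 𝔞.attach) (hs _ (hCV hz)).1
            𝔞.attach.continuous.continuousAt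
        · filter_upwards [𝔞.attach.continuous.continuousAt.preimage_mem_nhds
            (hV.mem_nhds (hCV hz))] with w hw
          rw [hτ, (hs _ hw).2]
      have hK : ∀ b : ZMod 2, IsClosed (Subtype.val '' {z | 𝔞.attach z ∈ C ∧ ε z = b}) := by
        intro b
        refine (𝔞.isClosed_bdry.isClosedEmbedding_subtypeVal.isClosedMap) _ ?_
        have hon : ContinuousOn ε (𝔞.attach ⁻¹' C) := fun z hz => (hε z hz).continuousWithinAt
        exact hon.preimage_isClosed_of_isClosed (hCc.preimage 𝔞.attach.continuous)
          (isClosed_discrete {b})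
      have hdisj : Disjoint (Subtype.val '' {z | 𝔞.attach z ∈ C ∧ ε z = 0})
          (Subtype.val '' {z | 𝔞.attach z ∈ C ∧ ε z = 1}) := by
        rw [Set.disjoint_left]
        rintro _ ⟨z, hz, rfl⟩ ⟨w, hw, hwz⟩
        obtain rfl : w = z := Subtype.ext hwz
        exact zero_ne_one (hz.2.symm.trans hw.2)
      obtain ⟨V₀, V₁, hV₀, hV₁, hK₀, hK₁, hVd⟩ := normal_separation (hK 0) (hK 1) hdisj
      have hzmod : ∀ c : ZMod 2, c = 0 ∨ c = 1 := by decide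
      have hind : ∀ z : 𝔞.bdry, 𝔞.attach z ∈ C →
          V₁.indicator (1 : D → ZMod 2) z = ε z ∧ z.1 ∈ V₀ ∪ V₁ := by
        intro z hz
        rcases hzmod (ε z) with h | h
        · have : z.1 ∈ V₀ := hK₀ ⟨z, ⟨hz, h⟩, rfl⟩
          exact ⟨by rw [h, indicator_of_notMem (Set.disjoint_left.1 hVd this)], Or.inl this⟩
        · have : z.1 ∈ V₁ := hK₁ ⟨z, ⟨hz, h⟩, rfl⟩
          exact ⟨by rw [h, indicator_of_mem this]; rfl, Or.inr this⟩
      have hh : ∀ x, ∃ c : ZMod 2, (∀ a, 𝔞.incl a = x → c = P.diff (s₀ a) (s a)) ∧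
          ∀ z ∉ 𝔞.bdry, 𝔞.char z = x → c = V₁.indicator 1 z := by
        intro x
        by_cases hx : ∃ a, 𝔞.incl a = x
        · obtain ⟨a, rfl⟩ := hx
          exact ⟨_, fun a' ha' => by rw [𝔞.incl_injective ha'],
            fun z hz hza => absurd hza.symm (𝔞.char_ne_incl z hz a)⟩
        · obtain ⟨z, rfl⟩ := (𝔞.cover x).resolve_left hx
          have hS : ∀ w, 𝔞.char w = 𝔞.char z → w ∈ 𝔞.bdryᶜ := fun w hw hwS =>
            hx ⟨_, (𝔞.incl_attach ⟨w, hwS⟩).trans hw⟩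
          exact ⟨_, fun a ha => absurd ⟨a, ha⟩ hx,
            fun w hw hwz => by rw [𝔞.char_injOn hw (hS z rfl) hwz]⟩
      choose h hA hD using hh
      -- Discarding the images of the bad parts of `A` and `D` leaves an open set, because both maps
      -- are closed.
      let U : Set X := (𝔞.incl '' (interior C)ᶜ)ᶜ ∩ (𝔞.char '' (V₀ ∪ V₁)ᶜ)ᶜ
      have hUA : ∀ a, 𝔞.incl a ∈ U → a ∈ interior C := fun a ha => by
        by_contra hn
        exact ha.1 ⟨a, hn, rfl⟩
      have hUD : ∀ z, 𝔞.char z ∈ U → z ∈ V₀ ∪ V₁ := fun z hz => by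
        by_contra hn
        exact hz.2 ⟨z, hn, rfl⟩
      have hUo : IsOpen U :=
        (𝔞.incl.continuous.isClosedMap _ isOpen_interior.isClosed_compl).isOpen_compl.inter
          (𝔞.char.continuous.isClosedMap _ (hV₀.union hV₁).isClosed_compl).isOpen_compl
      refine ⟨⟨(U, h), hUo, fun a ha => ?_, fun z hz => ?_⟩, ?_, ?_⟩
      · have haV' : a ∈ V := hCV (interior_subset (hUA a ha))
        refine (hs a haV').1.congr ?_
        filter_upwards [hV.mem_nhds haV'] with a' ha'
        rw [hA _ a' rfl, P.diff_vadd (by rw [hs₀, (hs a' ha').2])]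
      · refine (indicator_continuousAt hV₀ hV₁ hVd (hUD z hz)).congr ?_
        filter_upwards [(hUo.preimage 𝔞.char.continuous).mem_nhds hz] with w hw
        by_cases hwS : w ∈ 𝔞.bdry
        · have hwA := 𝔞.incl_attach ⟨w, hwS⟩
          have hwC : 𝔞.attach ⟨w, hwS⟩ ∈ C := interior_subset (hUA _ (by rw [hwA]; exact hw))
          rw [(hind ⟨w, hwS⟩ hwC).1, hA _ _ hwA, hr ⟨w, hwS⟩,
            P.diff_eq_iff (by rw [hτ, (hs _ (hCV hwC)).2]), add_vadd, P.diff_vadd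
              (by rw [hτ, hs₀]), P.diff_vadd (by rw [hs₀, (hs _ (hCV hwC)).2])]
        · rw [hD _ w hwS rfl, hr0 w hwS, add_zero]
      · rintro ⟨a, ha, haa⟩
        rw [𝔞.incl_injective haa] at ha
        exact ha (mem_interior_iff_mem_nhds.2 hC)
      · rintro ⟨z, hz, hza⟩
        have hzS : z ∈ 𝔞.bdry := by
          by_contra hzS
          exact 𝔞.char_ne_incl z hzS a₀ hza.symm
        have : 𝔞.attach ⟨z, hzS⟩ = a₀ := 𝔞.incl_injective ((𝔞.incl_attach _).trans hza)
        exact hz (hind ⟨z, hzS⟩ (by rw [this]; exact mem_of_mem_nhds hC)).2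
    -- Away from `A` the trivialization over the cell itself serves as local section.
    · refine ⟨⟨((range 𝔞.incl)ᶜ, 0), ?_, fun a ha => absurd ⟨a, rfl⟩ ha, fun z hz => ?_⟩, hx⟩
      · exact (isCompact_range 𝔞.incl.continuous).isClosed.isOpen_compl
      · have hzS : z ∈ 𝔞.bdryᶜ := fun hzS => hz ⟨_, 𝔞.incl_attach ⟨z, hzS⟩⟩
        refine (continuousAt_const (y := (0 : ZMod 2))).congr ?_
        filter_upwards [𝔞.isClosed_bdry.isOpen_compl.mem_nhds hzS] with w hw
        simp [hr0 w hw]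
  obtain ⟨Q, c, hc, hcs⟩ := exists_bundle_of_local_sections (fun i : ι => i.1.1)
    (fun i => i.2.1) hcover (fun i => i.1.2) fun i j x hx => by
      refine continuousAt_of_isClosedMap_cover 𝔞.incl.continuous.isClosedMap
        𝔞.char.continuous.isClosedMap 𝔞.cover (fun a ha => ?_) fun z hz => ?_
      · subst ha
        refine (P.continuousAt_diff (j.2.2.1 a hx.2) (i.2.2.1 a hx.1)
          (Filter.Eventually.of_forall fun a => by rw [P.proj_vadd, P.proj_vadd])).congr ?_
        refine Filter.Eventually.of_forall fun a => ?_
        change P.diff _ _ = i.1.2 (𝔞.incl a) - j.1.2 (𝔞.incl a)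
        rw [P.diff_eq_iff (by rw [P.proj_vadd, P.proj_vadd]), ← add_vadd, sub_add_cancel]
      · subst hz
        refine ((i.2.2.2 z hx.1).sub (j.2.2.2 z hx.2)).congr ?_
        exact Filter.Eventually.of_forall fun z => add_sub_add_right_eq_sub _ _ _
  refine ⟨Q, ⟨(Iso.toPullback 𝔞.incl
    (fun p => P.diff (s₀ (P.proj p)) p +ᵥ c (𝔞.incl (P.proj p))) ?_ (fun p => ?_)
    fun b p => ?_).symm⟩⟩
  · refine continuous_iff_continuousAt.2 fun p => ?_
    obtain ⟨i, hi⟩ := hcover (𝔞.incl (P.proj p))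
    have hπ : ContinuousAt P.proj p := P.continuous_proj.continuousAt
    -- Neither `s₀` nor `c` is continuous, but adding `h i` to both makes them so, and the two
    -- corrections cancel in the map.
    have h1 : ContinuousAt (fun q => i.1.2 (𝔞.incl (P.proj q)) +ᵥ c (𝔞.incl (P.proj q))) p :=
      ContinuousAt.comp' (g := fun x => i.1.2 x +ᵥ c x) (f := fun q => 𝔞.incl (P.proj q))
        (hcs i _ hi) (𝔞.incl.continuous.comp P.continuous_proj).continuousAt
    have h2 : ContinuousAt (fun q => i.1.2 (𝔞.incl (P.proj q)) +ᵥ s₀ (P.proj q)) p :=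
      ContinuousAt.comp' (g := fun a => i.1.2 (𝔞.incl a) +ᵥ s₀ a) (f := P.proj)
        (i.2.2.1 _ hi) hπ
    have h3 := P.continuousAt_diff h2 continuousAt_id (Filter.Eventually.of_forall fun q => by
      rw [P.proj_vadd, hs₀]; rfl)
    refine (Q.continuousAt_vadd h3 h1).congr (Filter.Eventually.of_forall fun q => ?_)
    have h4 := P.diff_vadd_vadd (i.1.2 (𝔞.incl (P.proj q))) 0 (p := s₀ (P.proj q)) (q := q)
      (hs₀ _)
    rw [zero_vadd, add_zero] at h4
    change P.diff _ q +ᵥ _ = _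
    rw [h4, ← add_vadd]
    congr 1
    linear_combination CharTwo.add_self_eq_zero (i.1.2 (𝔞.incl (P.proj q)))
  · rw [Q.proj_vadd, hc]
  · have h4 := P.diff_vadd_vadd 0 b (p := s₀ (P.proj p)) (q := p) (hs₀ _)
    rw [zero_vadd, zero_add] at h4
    rw [P.proj_vadd, h4, add_vadd]

end PrincipalBundle

/-! ### Bundles over balls and spheres -/

/-- The unit sphere of `ℝᵐ` with the maximum norm. -/
abbrev UnitSphere (m : ℕ) : Set (Fin m → ℝ) := Metric.sphere 0 1

namespace PrincipalBundle

variable {X : Type u} [TopologicalSpace X]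

/-- Bundles over a ball are trivial. -/
theorem exists_lift_closedBall {E : Type*} [NormedAddCommGroup E] [NormedSpace ℝ E]
    (P : PrincipalBundle X) (g : C(Metric.closedBall (0 : E) 1, X)) :
    ∃ s : C(Metric.closedBall (0 : E) 1, P.total), ∀ z, P.proj (s z) = g z := by
  have hmem : ∀ (t : I) (z : Metric.closedBall (0 : E) 1),
      (t : ℝ) • (z : E) ∈ Metric.closedBall (0 : E) 1 := fun t z => by
    have hz := mem_closedBall_zero_iff.1 z.2
    rw [mem_closedBall_zero_iff, norm_smul, Real.norm_of_nonneg t.2.1]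
    exact mul_le_one₀ t.2.2 (norm_nonneg _) hz
  let K : C(I × Metric.closedBall (0 : E) 1, Metric.closedBall (0 : E) 1) :=
    ⟨fun w => ⟨(w.1 : ℝ) • (w.2 : E), hmem w.1 w.2⟩, by fun_prop⟩
  obtain ⟨s, hs⟩ := P.exists_lift_of_nullhomotopic (g.comp K)
    (g ⟨0, Metric.mem_closedBall_self zero_le_one⟩)
    fun z => congrArg g (Subtype.ext (zero_smul ℝ (z : E)))
  exact ⟨s, fun z => (hs z).trans (congrArg g (Subtype.ext (one_smul ℝ (z : E))))⟩

/-- Bundles over a hemisphere are trivial. -/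
theorem exists_lift_hemisphere {m : ℕ} (P : PrincipalBundle X)
    (g : C(UnitSphere (m + 1), X)) (τ : ℝ) (hτ : τ * τ = 1) :
    ∃ s : C({z : UnitSphere (m + 1) // 0 ≤ τ * z.1 0}, P.total),
      ∀ z, P.proj (s z) = g z.1 := by
  -- The segment from the pole `Pi.single 0 τ` at time `0` to `z` at time `1`; normalizing it
  -- contracts the hemisphere.
  let v : I × {z : UnitSphere (m + 1) // 0 ≤ τ * z.1 0} → (Fin (m + 1) → ℝ) := fun w =>
    (w.1 : ℝ) • w.2.1.1 + (1 - w.1 : ℝ) • Pi.single 0 τ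
  have hv : Continuous v := by fun_prop
  -- On the hemisphere, `τ` times the zeroth coordinate is at least `1 - t`, so a zero could occur
  -- only at `t = 1`, where `v` is the unit vector `z`.
  have hv0 : ∀ w, v w ≠ 0 := by
    rintro ⟨t, z⟩ h
    have h0 : (t : ℝ) * z.1.1 0 + (1 - t) * τ = 0 := by simpa [v] using congr_fun h 0
    have h1 : (t : ℝ) * (τ * z.1.1 0) + (1 - t) = 0 := by
      linear_combination τ * h0 - (1 - (t : ℝ)) * hτ
    have h2 := mul_nonneg t.2.1 z.2
    have ht : (t : ℝ) = 1 := le_antisymm t.2.2 (by linarith)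
    have hz : z.1.1 = 0 := by simpa [v, ht] using h
    have hz1 : ‖z.1.1‖ = 1 := mem_sphere_zero_iff_norm.1 z.1.2
    rw [hz, norm_zero] at hz1
    exact zero_ne_one hz1
  have hu : ∀ w, ‖v w‖⁻¹ • v w ∈ UnitSphere (m + 1) := fun w => by
    rw [mem_sphere_zero_iff_norm, norm_smul, norm_inv, norm_norm,
      inv_mul_cancel₀ (norm_ne_zero_iff.2 (hv0 w))]
  have hc : Continuous fun w => ‖v w‖⁻¹ • v w :=
    (hv.norm.inv₀ fun w => norm_ne_zero_iff.2 (hv0 w)).smul hv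
  let K : C(I × {z : UnitSphere (m + 1) // 0 ≤ τ * z.1 0}, UnitSphere (m + 1)) :=
    ⟨fun w => ⟨‖v w‖⁻¹ • v w, hu w⟩, hc.subtype_mk hu⟩
  by_cases hne : Nonempty {z : UnitSphere (m + 1) // 0 ≤ τ * z.1 0}
  · obtain ⟨z₀⟩ := hne
    obtain ⟨s, hs⟩ := P.exists_lift_of_nullhomotopic (g.comp K) (g (K (0, z₀))) fun z =>
      congrArg g (Subtype.ext (by simp [K, v]))
    refine ⟨s, fun z => (hs z).trans (congrArg g (Subtype.ext ?_))⟩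
    have hz1 : ‖z.1.1‖ = 1 := mem_sphere_zero_iff_norm.1 z.1.2
    simp [K, v, hz1]
  · rw [not_nonempty_iff] at hne
    exact ⟨⟨fun z => hne.elim z, continuous_of_const fun z => hne.elim z⟩, fun z => hne.elim z⟩

theorem isConnected_sphere_pi {m : ℕ} (hm : 2 ≤ m) :
    IsConnected (UnitSphere m) :=
  isConnected_sphere (by rw [rank_fin_fun]; exact_mod_cast hm) 0 zero_le_one

/-- Bundles over a sphere of dimension at least two are trivial. -/
theorem exists_lift_sphere {m : ℕ} (hm : 2 ≤ m) (P : PrincipalBundle X)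
    (g : C(UnitSphere (m + 1), X)) :
    ∃ s : C(UnitSphere (m + 1), P.total), ∀ z, P.proj (s z) = g z := by
  classical
  obtain ⟨p, hp⟩ := P.exists_lift_hemisphere g 1 (by norm_num)
  obtain ⟨q, hq⟩ := P.exists_lift_hemisphere g (-1) (by norm_num)
  have hnorm : ∀ y : Fin m → ℝ, ‖(Fin.cons 0 y : Fin (m + 1) → ℝ)‖ = ‖y‖ := by
    intro y
    refine le_antisymm ((pi_norm_le_iff_of_nonneg (norm_nonneg _)).2 fun i => ?_)
      ((pi_norm_le_iff_of_nonneg (norm_nonneg _)).2 fun i => ?_)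
    · refine Fin.cases ?_ (fun i => ?_) i
      · simp
      · simpa using norm_le_pi_norm y i
    · simpa using norm_le_pi_norm (Fin.cons 0 y : Fin (m + 1) → ℝ) i.succ
  -- The equator. It is connected as `2 ≤ m`, so the sections over the two hemispheres differ there
  -- by a constant `c`, which is absorbed into one of them.
  let e : UnitSphere m → UnitSphere (m + 1) := fun y => ⟨Fin.cons 0 y.1, by
    rw [mem_sphere_zero_iff_norm, hnorm, mem_sphere_zero_iff_norm.1 y.2]⟩
  have he : Continuous e := by
    refine Continuous.subtype_mk (continuous_pi fun i => ?_) _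
    refine Fin.cases ?_ (fun i => ?_) i
    · exact continuous_const
    · exact (continuous_apply i).comp continuous_subtype_val
  have he1 : ∀ y, 0 ≤ (1 : ℝ) * (e y).1 0 := fun y => by simp [e]
  have he2 : ∀ y, 0 ≤ (-1 : ℝ) * (e y).1 0 := fun y => by simp [e]
  have hconn := isConnected_iff_connectedSpace.1 (isConnected_sphere_pi hm)
  have hd : Continuous fun y => P.diff (p ⟨e y, he1 y⟩) (q ⟨e y, he2 y⟩) :=
    P.continuous_diff (p.continuous.comp (he.subtype_mk _)) (q.continuous.comp (he.subtype_mk _))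
      fun y => by rw [hp, hq]
  obtain ⟨y₀⟩ : Nonempty (UnitSphere m) := inferInstance
  have hconst : ∀ y, P.diff (p ⟨e y, he1 y⟩) (q ⟨e y, he2 y⟩) =
      P.diff (p ⟨e y₀, he1 y₀⟩) (q ⟨e y₀, he2 y₀⟩) := fun y =>
    PreconnectedSpace.constant inferInstance hd
  set c := P.diff (p ⟨e y₀, he1 y₀⟩) (q ⟨e y₀, he2 y₀⟩)
  let s : UnitSphere (m + 1) → P.total := fun z =>
    if h : 0 ≤ (1 : ℝ) * z.1 0 then c +ᵥ p ⟨z, h⟩ else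
      q ⟨z, by rw [one_mul, not_le] at h; linarith⟩
  have hs1 : ∀ z : {z : UnitSphere (m + 1) // 0 ≤ (1 : ℝ) * z.1 0}, s z = c +ᵥ p z := fun z => dif_pos z.2
  have hs2 : ∀ z : {z : UnitSphere (m + 1) // 0 ≤ (-1 : ℝ) * z.1 0}, s z = q z := by
    intro z
    by_cases h : 0 ≤ (1 : ℝ) * z.1.1 0
    · refine (hs1 ⟨z, h⟩).trans ?_
      have hz0 : z.1.1 0 = 0 := by have := z.2; linarith
      have htail : (Fin.cons 0 (Fin.tail z.1.1) : Fin (m + 1) → ℝ) = z.1.1 := by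
        funext i
        refine Fin.cases hz0.symm (fun i => rfl) i
      let y : UnitSphere m := ⟨Fin.tail z.1.1, by
        rw [mem_sphere_zero_iff_norm, ← hnorm, htail, mem_sphere_zero_iff_norm.1 z.1.2]⟩
      have hez : e y = z.1 := Subtype.ext htail
      have h1 : (⟨z, h⟩ : {z : UnitSphere (m + 1) // 0 ≤ (1 : ℝ) * z.1 0}) = ⟨e y, he1 y⟩ := Subtype.ext hez.symm
      have h2 : z = ⟨e y, he2 y⟩ := Subtype.ext hez.symm
      rw [h1, h2, ← hconst y, P.diff_vadd (by rw [hp, hq])]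
    · exact dif_neg h
  have hcover : ∀ z : UnitSphere (m + 1), (∃ w : {z : UnitSphere (m + 1) // 0 ≤ (1 : ℝ) * z.1 0}, w.1 = z) ∨
      ∃ w : {z : UnitSphere (m + 1) // 0 ≤ (-1 : ℝ) * z.1 0}, w.1 = z := by
    intro z
    rcases le_total 0 (z.1 0) with h | h
    · exact Or.inl ⟨⟨z, by linarith⟩, rfl⟩
    · exact Or.inr ⟨⟨z, by linarith⟩, rfl⟩
  have hclosed : ∀ τ : ℝ, IsClosedMap (Subtype.val : {z : UnitSphere (m + 1) // 0 ≤ τ * z.1 0} → UnitSphere (m + 1)) := fun τ => by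
    have : IsClosed {z : UnitSphere (m + 1) | 0 ≤ τ * z.1 0} := isClosed_le continuous_const
        (continuous_const.mul ((continuous_apply 0).comp continuous_subtype_val))
    exact this.isClosedEmbedding_subtypeVal.isClosedMap
  refine ⟨⟨s, continuous_iff_continuousAt.2 fun z => ?_⟩, fun z => ?_⟩
  · refine continuousAt_of_isClosedMap_cover (hclosed 1) (hclosed (-1)) hcover
      (fun w _ => ?_) fun w _ => ?_
    · rw [show s ∘ Subtype.val = fun w => c +ᵥ p w from funext hs1]
      exact ((P.continuous_vadd c).comp p.continuous).continuousAt
    · rw [show s ∘ Subtype.val = q from funext hs2]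
      exact q.continuous.continuousAt
  · rcases hcover z with ⟨w, rfl⟩ | ⟨w, rfl⟩
    · exact (congrArg P.proj (hs1 w)).trans ((P.proj_vadd _ _).trans (hp w))
    · exact (congrArg P.proj (hs2 w)).trans (hq w)

end PrincipalBundle

/-! ### Extending bundles and isomorphisms over skeleta -/

namespace PrincipalBundle

variable {X Y : Type u} [TopologicalSpace X] [TopologicalSpace Y] {S : Type*} [TopologicalSpace S]

theorem holonomy_eq_zero_iff (P : PrincipalBundle X) (γ : C(S, X)) :
    P.holonomy γ = 0 ↔ ∃ s : C(S, P.total), ∀ z, P.proj (s z) = γ z := by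
  unfold holonomy
  split_ifs with h
  · exact iff_of_true rfl h
  · exact iff_of_false one_ne_zero h

theorem holonomy_pullback (P : PrincipalBundle X) (g : C(Y, X)) (γ : C(S, Y)) :
    (P.pullback g).holonomy γ = P.holonomy (g.comp γ) := by
  have key : (∃ s : C(S, (P.pullback g).total), ∀ z, (P.pullback g).proj (s z) = γ z) ↔
      ∃ s : C(S, P.total), ∀ z, P.proj (s z) = g.comp γ z := by
    constructor
    · rintro ⟨s, hs⟩
      exact ⟨⟨fun z => (s z).1.2, (P.continuous_pullback_snd g).comp s.continuous⟩, fun z =>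
        (s z).2.symm.trans (congrArg g (hs z))⟩
    · rintro ⟨s, hs⟩
      exact ⟨⟨fun z => P.pullbackMk g (γ z) (s z) (hs z).symm,
        (γ.continuous.prodMk s.continuous).subtype_mk _⟩, fun z => rfl⟩
  have hz : ∀ a b : ZMod 2, (a = 0 ↔ b = 0) → a = b := by decide
  exact hz _ _ (by rw [holonomy_eq_zero_iff, holonomy_eq_zero_iff, key])

end PrincipalBundle

namespace CWStructure

variable {M : Type u} [TopologicalSpace M] (Ξ : CWStructure M)

theorem eq_of_mem_openCell {m n : ℕ} {c : Ξ.Cell m} {c' : Ξ.Cell n} {x : M}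
    (h : x ∈ Ξ.openCell c) (h' : x ∈ Ξ.openCell c') :
    (⟨m, c⟩ : Σ k, Ξ.Cell k) = ⟨n, c'⟩ := by
  by_contra hne
  exact Set.disjoint_left.1 (Topology.CWComplex.pairwiseDisjoint' (self := Ξ) (mem_univ _)
    (mem_univ _) hne) h h'

variable [T2Space M]

theorem isClosed_skel (k : ℕ) : IsClosed (Ξ.skel k) :=
  letI := Ξ
  (RelCWComplex.skeleton (univ : Set M) k).closed

instance compactSpace_skel [CompactSpace M] (k : ℕ) : CompactSpace (Ξ.skel k) :=
  isCompact_iff_compactSpace.1 (Ξ.isClosed_skel k).isCompact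

theorem charMap_mem_skel {k : ℕ} (c : Ξ.Cell k) {z : Fin k → ℝ}
    (hz : z ∈ Metric.closedBall (0 : Fin k → ℝ) 1) : Ξ.charMap c z ∈ Ξ.skel k := by
  let := Ξ
  exact CWComplex.closedCell_subset_skeleton (C := (univ : Set M)) k c (mem_image_of_mem _ hz)

theorem charMap_mem_skel_of_sphere {k : ℕ} (c : Ξ.Cell (k + 1)) {z : Fin (k + 1) → ℝ}
    (hz : z ∈ UnitSphere (k + 1)) : Ξ.charMap c z ∈ Ξ.skel k := by
  let := Ξ
  exact CWComplex.cellFrontier_subset_skeleton (C := (univ : Set M)) k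
    (show RelCWComplex.cell (univ : Set M) (k + 1) from c) (mem_image_of_mem _ hz)

/-- The characteristic map of a cell on the closed ball. -/
def closedChar {k : ℕ} (c : Ξ.Cell k) : C(Metric.closedBall (0 : Fin k → ℝ) 1, Ξ.skel k) where
  toFun z := ⟨Ξ.charMap c z, Ξ.charMap_mem_skel c z.2⟩
  continuous_toFun := (continuousOn_iff_continuous_domRestrict.1
    (Topology.CWComplex.continuousOn (self := Ξ) k c)).subtype_mk _

/-- The attaching map of a cell. -/
def cellAttach {k : ℕ} (c : Ξ.Cell (k + 1)) : C(UnitSphere (k + 1), Ξ.skel k) where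
  toFun z := ⟨Ξ.charMap c z, Ξ.charMap_mem_skel_of_sphere c z.2⟩
  continuous_toFun := (continuousOn_iff_continuous_domRestrict.1
    ((Topology.CWComplex.continuousOn (self := Ξ) (k + 1) c).mono
      Metric.sphere_subset_closedBall)).subtype_mk _

/-- The inclusion of a skeleton in the next one. -/
def skelIncl (k : ℕ) : C(Ξ.skel k, Ξ.skel (k + 1)) :=
  ⟨fun x => ⟨x, Ξ.skel_mono k.le_succ x.2⟩, continuous_subtype_val.subtype_mk _⟩

/-- The inclusion of a skeleton. -/
def skelVal (k : ℕ) : C(Ξ.skel k, M) := ⟨Subtype.val, continuous_subtype_val⟩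

/-- The `(k + 1)`-skeleton is obtained from the `k`-skeleton by attaching balls. -/
def skelAttachment (k : ℕ) : Attachment (Ξ.skel k) (Ξ.skel (k + 1))
    (Σ _ : Ξ.Cell (k + 1), Metric.closedBall (0 : Fin (k + 1) → ℝ) 1) where
  incl := Ξ.skelIncl k
  char := ⟨fun w => Ξ.closedChar w.1 w.2, continuous_sigma fun c => (Ξ.closedChar c).continuous⟩
  bdry := {w | w.2.1 ∈ UnitSphere (k + 1)}
  attach := by
    refine ⟨fun w => Ξ.cellAttach w.1.1 ⟨w.1.2.1, w.2⟩, Continuous.subtype_mk ?_ _⟩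
    exact (continuous_subtype_val.comp
      (continuous_sigma fun c => (Ξ.closedChar c).continuous :
        Continuous fun w : Σ _ : Ξ.Cell (k + 1), Metric.closedBall (0 : Fin (k + 1) → ℝ) 1 =>
          Ξ.closedChar w.1 w.2)).comp continuous_subtype_val
  incl_injective x y h := Subtype.ext (congrArg (fun z : Ξ.skel (k + 1) => (z : M)) h)
  isClosed_bdry := isClosed_sigma_iff.2 fun _ => Metric.isClosed_sphere.preimage
    continuous_subtype_val
  incl_attach _ := rfl
  char_injOn := by
    rintro ⟨c, z⟩ hz ⟨c', z'⟩ hz' h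
    have hball : ∀ w : Metric.closedBall (0 : Fin (k + 1) → ℝ) 1, w.1 ∉ UnitSphere (k + 1) →
        w.1 ∈ Metric.ball (0 : Fin (k + 1) → ℝ) 1 := fun w hw =>
      lt_of_le_of_ne (Metric.mem_closedBall.1 w.2) hw
    have h' : Ξ.charMap c z = Ξ.charMap c' z' := congrArg (fun z : Ξ.skel (k + 1) => (z : M)) h
    obtain rfl : c = c' := by
      have := Ξ.eq_of_mem_openCell (c := c) (c' := c') (mem_image_of_mem _ (hball z hz))
        (by rw [h']; exact mem_image_of_mem _ (hball z' hz'))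
      exact eq_of_heq (Sigma.mk.inj this).2
    have hsrc : (Ξ.charMap c).source = Metric.ball 0 1 :=
      Topology.CWComplex.source_eq (self := Ξ) _ c
    have : z = z' := Subtype.ext ((Ξ.charMap c).injOn (by rw [hsrc]; exact hball z hz)
      (by rw [hsrc]; exact hball z' hz') h')
    rw [this]
  char_ne_incl := by
    rintro ⟨c, z⟩ hz a h
    have hzb : z.1 ∈ Metric.ball (0 : Fin (k + 1) → ℝ) 1 :=
      lt_of_le_of_ne (Metric.mem_closedBall.1 z.2) hz
    have h' : (a : M) = Ξ.charMap c z := congrArg (fun z : Ξ.skel (k + 1) => (z : M)) h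
    obtain ⟨m, hm, c', hc'⟩ := Ξ.mem_skel_iff.1 a.2
    have := Ξ.eq_of_mem_openCell (c := c) (mem_image_of_mem _ hzb) (h' ▸ hc')
    have := congrArg Sigma.fst this
    simp only at this
    omega
  cover := by
    rintro ⟨x, hx⟩
    obtain ⟨m, hm, c, hc⟩ := Ξ.mem_skel_iff.1 hx
    rcases hm.lt_or_eq with hm | rfl
    · exact Or.inl ⟨⟨x, Ξ.mem_skel_iff.2 ⟨m, Nat.lt_succ_iff.1 hm, c, hc⟩⟩, rfl⟩
    · obtain ⟨z, hz, rfl⟩ := hc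
      exact Or.inr ⟨⟨c, ⟨z, Metric.ball_subset_closedBall hz⟩⟩, rfl⟩

/-- The attaching loop bounds the closed 2-cell, over which the bundle has a section. -/
theorem holonomy_attach_of_pullback (P : PrincipalBundle M) (c : Ξ.Cell 2) :
    (P.pullback (Ξ.skelVal 1)).holonomy (Ξ.attach c) = 0 := by
  rw [PrincipalBundle.holonomy_pullback, PrincipalBundle.holonomy_eq_zero_iff]
  obtain ⟨s, hs⟩ := P.exists_lift_closedBall ((Ξ.skelVal 2).comp (Ξ.closedChar c))
  let i : UnitSphere 2 → Metric.closedBall (0 : Fin 2 → ℝ) 1 :=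
    fun z => ⟨z, Metric.sphere_subset_closedBall z.2⟩
  exact ⟨⟨fun z => s (i z), s.continuous.comp (continuous_subtype_val.subtype_mk _)⟩,
    fun z => hs (i z)⟩

variable [CompactSpace M]

/-- A bundle on the `(k + 1)`-skeleton, `k ≥ 1`, is determined by its restriction to the
`k`-skeleton. -/
theorem pullback_skelIncl_injective {k : ℕ} (hk : 1 ≤ k) :
    Function.Injective (BunClass.pullback (Ξ.skelIncl k)) := by
  intro P Q h
  obtain ⟨P, rfl⟩ := P.exists_rep
  obtain ⟨Q, rfl⟩ := Q.exists_rep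
  obtain ⟨φ⟩ := BunClass.mk_eq_mk.1 h
  refine BunClass.mk_eq_mk.2 ?_
  choose p hp using fun c : Ξ.Cell (k + 1) => P.exists_lift_closedBall (Ξ.closedChar c)
  choose q hq using fun c : Ξ.Cell (k + 1) => Q.exists_lift_closedBall (Ξ.closedChar c)
  let i : UnitSphere (k + 1) → Metric.closedBall (0 : Fin (k + 1) → ℝ) 1 :=
    fun z => ⟨z, Metric.sphere_subset_closedBall z.2⟩
  have hi : Continuous i := continuous_subtype_val.subtype_mk _
  let r : Ξ.Cell (k + 1) → UnitSphere (k + 1) → Q.total := fun c z =>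
    (φ.toHomeomorph (P.pullbackMk _ (Ξ.cellAttach c z) (p c (i z)) (hp c (i z)).symm)).1.2
  have hr : ∀ c, Continuous (r c) := fun c =>
    (Q.continuous_pullback_snd _).comp (φ.toHomeomorph.continuous.comp
      (((Ξ.cellAttach c).continuous.prodMk ((p c).continuous.comp hi)).subtype_mk _))
  have hrq : ∀ c z, Q.proj (q c (i z)) = Q.proj (r c z) := by
    intro c z
    rw [hq]
    refine Eq.trans ?_ (φ.toHomeomorph (P.pullbackMk _ (Ξ.cellAttach c z) (p c (i z)) _)).2
    exact congrArg (Ξ.skelIncl k) (φ.proj_eq (P.pullbackMk _ (Ξ.cellAttach c z) (p c (i z)) _)).symm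
  have hconn := isConnected_iff_connectedSpace.1
    (PrincipalBundle.isConnected_sphere_pi (Nat.succ_le_succ hk))
  -- The boundary sphere of a cell is connected because `1 ≤ k`; the mismatch of `φ` with the chosen
  -- sections is constant on it and extends as a constant over the ball.
  have hconst : ∀ c, ∃ ε : ZMod 2, ∀ z, Q.diff (q c (i z)) (r c z) = ε := by
    intro c
    obtain ⟨z₀⟩ := hconn.toNonempty
    exact ⟨_, fun z => PreconnectedSpace.constant inferInstance
      (Q.continuous_diff ((q c).continuous.comp hi) (hr c) (hrq c)) (y := z₀)⟩
  choose ε hε using hconst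
  refine PrincipalBundle.nonempty_iso_of_attachment (Ξ.skelAttachment k) φ
    ⟨fun w => p w.1 w.2, continuous_sigma fun c => (p c).continuous⟩
    ⟨fun w => q w.1 w.2, continuous_sigma fun c => (q c).continuous⟩
    (fun w => hp w.1 w.2) (fun w => hq w.1 w.2)
    ⟨fun w => ε w.1, continuous_sigma fun c => (continuous_const :
      Continuous fun _ : Metric.closedBall (0 : Fin (k + 1) → ℝ) 1 => ε c)⟩ ?_
  rintro ⟨⟨c, z⟩, hz⟩
  exact ((Q.diff_eq_iff (hrq c ⟨z, hz⟩)).1 (hε c ⟨z, hz⟩)).symm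

/-- A bundle on the `k`-skeleton which is trivial along the attaching maps extends to the
`(k + 1)`-skeleton. -/
theorem exists_extension_skel {k : ℕ} (P : PrincipalBundle (Ξ.skel k))
    (h : ∀ c : Ξ.Cell (k + 1), ∃ s : C(UnitSphere (k + 1), P.total),
      ∀ z, P.proj (s z) = Ξ.cellAttach c z) :
    ∃ Q : BunClass (Ξ.skel (k + 1)), Q.pullback (Ξ.skelIncl k) = BunClass.mk P := by
  choose s hs using h
  -- The boundary of the disjoint union of balls is a quotient of the disjoint union of spheres,
  -- which is compact since there are finitely many cells. Continuity can thus be checked cell by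
  -- cell.
  have hcont : Continuous fun w : (Ξ.skelAttachment k).bdry => s w.1.1 ⟨w.1.2.1, w.2⟩ := by
    let e : (Σ _ : Ξ.Cell (k + 1), UnitSphere (k + 1)) → (Ξ.skelAttachment k).bdry :=
      fun w => ⟨⟨w.1, ⟨w.2.1, Metric.sphere_subset_closedBall w.2.2⟩⟩, w.2.2⟩
    have he : Continuous e := by
      refine Continuous.subtype_mk (continuous_sigma fun c => ?_) _
      exact continuous_sigmaMk.comp (continuous_subtype_val.subtype_mk _)
    have hq : IsQuotientMap e := he.isClosedMap.isQuotientMap he fun w =>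
      ⟨⟨w.1.1, ⟨w.1.2.1, w.2⟩⟩, rfl⟩
    exact hq.continuous_iff.2 (continuous_sigma fun c => (s c).continuous)
  obtain ⟨Q, ⟨φ⟩⟩ := PrincipalBundle.exists_extension_of_attachment (Ξ.skelAttachment k) P
    ⟨fun w => s w.1.1 ⟨w.1.2.1, w.2⟩, hcont⟩ fun w => hs w.1.1 _
  exact ⟨BunClass.mk Q, BunClass.mk_eq_mk.2 ⟨φ⟩⟩

/-- Finitely many cells have bounded dimension. This ends the inductions over skeleta without
comparing cell dimensions to the dimension of `M`. -/
theorem exists_skel_eq_univ : ∃ n, ∀ k ≥ n, Ξ.skel k = univ := by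
  have := Ξ.finite_cells
  obtain ⟨n, hn⟩ := (Set.finite_range fun s : Σ k, Ξ.Cell k => s.1).bddAbove
  refine ⟨n, fun k hk => eq_univ_of_forall fun x => ?_⟩
  have hx : x ∈ (univ : Set M) := mem_univ x
  rw [← Topology.CWComplex.union' (self := Ξ)] at hx
  simp only [mem_iUnion] at hx
  obtain ⟨m, c, z, hz, rfl⟩ := hx
  exact Ξ.skel_mono ((hn ⟨⟨m, c⟩, rfl⟩).trans hk) (Ξ.charMap_mem_skel c hz)

/-- The inverse of the inclusion of a skeleton which is the whole space. -/
def toSkel {k : ℕ} (h : Ξ.skel k = univ) : C(M, Ξ.skel k) :=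
  ⟨fun x => ⟨x, h ▸ mem_univ x⟩, continuous_id.subtype_mk _⟩

/-- Bundles on `M` are determined by their restriction to the `1`-skeleton. -/
theorem pullback_skelVal_injective : Function.Injective (BunClass.pullback (Ξ.skelVal 1)) := by
  intro P Q h
  have key : ∀ k, 1 ≤ k → P.pullback (Ξ.skelVal k) = Q.pullback (Ξ.skelVal k) := by
    intro k hk
    induction k, hk using Nat.le_induction with
    | base => exact h
    | succ k hk ih =>
      refine Ξ.pullback_skelIncl_injective hk ?_
      rw [BunClass.pullback_pullback, BunClass.pullback_pullback]
      exact ih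
  obtain ⟨n, hn⟩ := Ξ.exists_skel_eq_univ
  -- Taking `n + 1` instead of `n` secures the bound `1 ≤ k` required by `key`.
  have hn1 := hn (n + 1) n.le_succ
  have h' := congrArg (BunClass.pullback (Ξ.toSkel hn1)) (key (n + 1) (Nat.le_add_left 1 n))
  rw [BunClass.pullback_pullback, BunClass.pullback_pullback] at h'
  exact (P.pullback_id.symm.trans h').trans Q.pullback_id

/-- Bundles on the `1`-skeleton with trivial holonomy around the `2`-cells extend to `M`. -/
theorem exists_extension (P : PrincipalBundle (Ξ.skel 1))
    (h : ∀ c : Ξ.Cell 2, P.holonomy (Ξ.attach c) = 0) :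
    ∃ Q : BunClass M, Q.pullback (Ξ.skelVal 1) = BunClass.mk P := by
  let j : ∀ k, 2 ≤ k → C(Ξ.skel 1, Ξ.skel k) := fun k hk =>
    ⟨fun x => ⟨x, Ξ.skel_mono (one_le_two.trans hk) x.2⟩, continuous_subtype_val.subtype_mk _⟩
  have key : ∀ (k : ℕ) (hk : 2 ≤ k), ∃ Q : BunClass (Ξ.skel k),
      Q.pullback (j k hk) = BunClass.mk P := by
    intro k hk
    induction k, hk using Nat.le_induction with
    | base => exact Ξ.exists_extension_skel P fun c => (P.holonomy_eq_zero_iff _).1 (h c)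
    | succ k hk ih =>
      obtain ⟨Q, hQ⟩ := ih
      obtain ⟨Q, rfl⟩ := Q.exists_rep
      -- The attaching sphere has dimension `k ≥ 2`, so there is no obstruction.
      obtain ⟨R, hR⟩ := Ξ.exists_extension_skel Q fun c =>
        Q.exists_lift_sphere hk (Ξ.cellAttach c)
      refine ⟨R, ?_⟩
      rw [← hQ, ← hR, BunClass.pullback_pullback]
      rfl
  obtain ⟨n, hn⟩ := Ξ.exists_skel_eq_univ
  obtain ⟨Q, hQ⟩ := key (n + 2) (Nat.le_add_left 2 n)
  refine ⟨Q.pullback (Ξ.toSkel (hn (n + 2) (Nat.le_add_right n 2))), ?_⟩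
  rw [← hQ, BunClass.pullback_pullback]
  rfl

end CWStructure

/-! ### Trivialized bundles -/

namespace RelBunClass

variable {X Y : Type u} [TopologicalSpace X] [TopologicalSpace Y] {A : Set X} {B : Set Y}

/-- The class of the underlying bundle. -/
def toBunClass : RelBunClass X A → BunClass X :=
  Quotient.map RelBundle.bundle fun _ _ ⟨φ, _⟩ => ⟨φ⟩

theorem exists_rep (E : RelBunClass X A) : ∃ F, mk F = E := Quotient.exists_rep E

theorem toBunClass_shift (t : C(A, ZMod 2)) (E : RelBunClass X A) :
    (E.shift t).toBunClass = E.toBunClass := by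
  obtain ⟨E, rfl⟩ := E.exists_rep
  rfl

theorem toBunClass_pullback (g : C(Y, X)) (hg : MapsTo g B A) (E : RelBunClass X A) :
    (E.pullback g hg).toBunClass = E.toBunClass.pullback g := by
  obtain ⟨E, rfl⟩ := E.exists_rep
  rfl

theorem holonomy_eq_of_toBunClass_eq {S : Type*} [TopologicalSpace S] (γ : C(S, X))
    {E F : RelBunClass X A} (h : E.toBunClass = F.toBunClass) : E.holonomy γ = F.holonomy γ := by
  obtain ⟨E, rfl⟩ := E.exists_rep
  obtain ⟨F, rfl⟩ := F.exists_rep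
  obtain ⟨φ⟩ := BunClass.mk_eq_mk.1 h
  exact PrincipalBundle.holonomy_congr φ γ

theorem holonomy_pullback {S : Type*} [TopologicalSpace S] (g : C(Y, X)) (hg : MapsTo g B A)
    (γ : C(S, Y)) (E : RelBunClass X A) :
    (E.pullback g hg).holonomy γ = E.holonomy (g.comp γ) := by
  obtain ⟨E, rfl⟩ := E.exists_rep
  exact E.bundle.holonomy_pullback g γ

theorem shift_shift (s t : C(A, ZMod 2)) (E : RelBunClass X A) :
    (E.shift t).shift s = E.shift (s + t) := by
  obtain ⟨E, rfl⟩ := E.exists_rep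
  exact Quotient.sound ⟨PrincipalBundle.Iso.refl _, fun a => (add_vadd (s a) (t a) _).symm⟩

theorem shift_zero (E : RelBunClass X A) : E.shift 0 = E := by
  obtain ⟨E, rfl⟩ := E.exists_rep
  exact Quotient.sound ⟨PrincipalBundle.Iso.refl _, fun a => zero_vadd _ _⟩

/-- Two trivializations of a bundle differ by a shift. -/
theorem exists_shift_eq {E F : RelBunClass X A} (h : E.toBunClass = F.toBunClass) :
    ∃ t, E.shift t = F := by
  obtain ⟨E, rfl⟩ := E.exists_rep
  obtain ⟨F, rfl⟩ := F.exists_rep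
  obtain ⟨φ⟩ := BunClass.mk_eq_mk.1 h
  have hp : ∀ a, F.bundle.proj (φ.toHomeomorph (E.triv a)) = F.bundle.proj (F.triv a) := fun a => by
    rw [φ.proj_eq, E.proj_triv, F.proj_triv]
  refine ⟨⟨fun a => F.bundle.diff (φ.toHomeomorph (E.triv a)) (F.triv a),
    F.bundle.continuous_diff (φ.toHomeomorph.continuous.comp E.triv.continuous)
      F.triv.continuous hp⟩, Quotient.sound ⟨φ, fun a => ?_⟩⟩
  exact (φ.map_vadd _ _).trans (F.bundle.diff_vadd (hp a))

end RelBunClass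

/-! ### Ground states -/

/-- A vector killed by a sum of commuting idempotents is killed by each of them. -/
theorem apply_eq_zero_of_sum_idempotent {ι V : Type*} [AddCommGroup V] [Module ℂ V]
    {p : ι → Module.End ℂ V} (hp : ∀ i, IsIdempotentElem (p i)) (hc : ∀ i j, Commute (p i) (p j))
    (s : Finset ι) : ∀ (c : ℕ) (x : V), (∑ i ∈ s, p i) x + (c : ℂ) • x = 0 →
      ∀ i ∈ s, p i x = 0 := by
  classical
  induction s using Finset.induction_on with
  | empty => simp
  | insert j s hj ih =>
    intro c x hx
    rw [Finset.sum_insert hj, LinearMap.add_apply] at hx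
    have hjj : p j (p j x) = p j x := LinearMap.congr_fun (hp j) x
    have hcom : p j ((∑ i ∈ s, p i) x) = (∑ i ∈ s, p i) (p j x) :=
      LinearMap.congr_fun (Commute.sum_right s p (p j) fun i _ => hc j i) x
    -- Applying `p j` gives the same equation for `p j x` with `c + 1` in place of `c`; the general
    -- `c` in the statement is there for this. By induction the other idempotents kill `p j x`,
    -- leaving `(c + 1) • p j x = 0`.
    have h1 := congrArg (p j) hx
    simp only [map_add, map_smul, hjj, hcom, map_zero] at h1
    have h2 : (∑ i ∈ s, p i) (p j x) + ((c + 1 : ℕ) : ℂ) • p j x = 0 := by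
      rw [← h1, Nat.cast_succ, add_smul, one_smul]
      abel
    have h3 := ih _ _ h2
    have h4 : (∑ i ∈ s, p i) (p j x) = 0 := by
      rw [LinearMap.sum_apply]
      exact Finset.sum_eq_zero h3
    rw [h4, zero_add] at h2
    have h5 : p j x = 0 := (smul_eq_zero.1 h2).resolve_left (Nat.cast_ne_zero.2 c.succ_ne_zero)
    intro i hi
    rcases Finset.mem_insert.1 hi with rfl | hi
    · exact h5
    · refine ih c x ?_ i hi
      rwa [h5, zero_add] at hx

theorem isIdempotentElem_half_one_sub {V : Type*} [AddCommGroup V] [Module ℂ V]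
    {a : Module.End ℂ V} (ha : a * a = 1) : IsIdempotentElem ((1 / 2 : ℂ) • (1 - a)) := by
  unfold IsIdempotentElem
  rw [smul_mul_smul_comm, sub_mul, one_mul, mul_sub, mul_one, ha]
  rw [show (1 - a - (a - 1) : Module.End ℂ V) = (2 : ℂ) • (1 - a) by rw [two_smul]; abel, smul_smul]
  norm_num

theorem commute_half_one_sub {V : Type*} [AddCommGroup V] [Module ℂ V] {a b : Module.End ℂ V}
    (h : Commute a b) : Commute ((1 / 2 : ℂ) • (1 - a)) ((1 / 2 : ℂ) • (1 - b)) :=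
  Commute.smul_left (Commute.smul_right ((Commute.one_left _).sub_left
    ((Commute.one_right _).sub_right h)) _) _

namespace ToricCode

open CWStructure

variable {M : Type u} [TopologicalSpace M] [T2Space M] (Ξ : CWStructure M)

theorem holonomy_shift (t : C(Ξ.skel₀, ZMod 2)) (f : Ξ.Cell 2) (E : Field Ξ) :
    (E.shift t).holonomy (Ξ.attach f) = E.holonomy (Ξ.attach f) :=
  RelBunClass.holonomy_eq_of_toBunClass_eq _ (E.toBunClass_shift t)

variable [CompactSpace M]

/-- The vertex and face operators. -/
noncomputable def localOp : Ξ.Cell 0 ⊕ Ξ.Cell 2 → Module.End ℂ (State Ξ) :=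
  Sum.elim (shiftOp Ξ) (holOp Ξ)

theorem localOp_mul_self (i : Ξ.Cell 0 ⊕ Ξ.Cell 2) : localOp Ξ i * localOp Ξ i = 1 := by
  refine LinearMap.ext fun ψ => funext fun E => ?_
  rcases i with v | f
  · change ψ ((E.shift (Ξ.delta v)).shift (Ξ.delta v)) = ψ E
    rw [RelBunClass.shift_shift, show Ξ.delta v + Ξ.delta v = 0 from
      ContinuousMap.ext fun x => CharTwo.add_self_eq_zero _, RelBunClass.shift_zero]
  · change (-1 : ℂ) ^ (E.holonomy (Ξ.attach f)).val *
      ((-1 : ℂ) ^ (E.holonomy (Ξ.attach f)).val * ψ E) = ψ E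
    rw [← mul_assoc, ← mul_pow, neg_one_mul, neg_neg, one_pow, one_mul]

theorem localOp_commute (i j : Ξ.Cell 0 ⊕ Ξ.Cell 2) :
    Commute (localOp Ξ i) (localOp Ξ j) := by
  have key : ∀ v f, Commute (shiftOp Ξ v : Module.End ℂ (State Ξ)) (holOp Ξ f) := fun v f => by
    refine LinearMap.ext fun ψ => funext fun E => ?_
    change (-1 : ℂ) ^ ((E.shift (Ξ.delta v)).holonomy (Ξ.attach f)).val *
        ψ (E.shift (Ξ.delta v)) =
      (-1 : ℂ) ^ (E.holonomy (Ξ.attach f)).val * ψ (E.shift (Ξ.delta v))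
    rw [holonomy_shift]
  rcases i with v | f <;> rcases j with w | g
  · refine LinearMap.ext fun ψ => funext fun E => ?_
    change ψ ((E.shift (Ξ.delta v)).shift (Ξ.delta w)) =
      ψ ((E.shift (Ξ.delta w)).shift (Ξ.delta v))
    rw [RelBunClass.shift_shift, RelBunClass.shift_shift, add_comm]
  · exact key v g
  · exact (key w f).symm
  · exact LinearMap.ext fun ψ => funext fun E => mul_left_comm _ _ _

theorem hamiltonian_eq :
    hamiltonian Ξ = ∑ i : Ξ.Cell 0 ⊕ Ξ.Cell 2, (1 / 2 : ℂ) • (1 - localOp Ξ i) := by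
  rw [Fintype.sum_sum_type]
  rfl

/-- Each summand of the Hamiltonian is half of one minus an involution, hence idempotent, and the
summands commute. No inner product or positivity is used. -/
theorem mem_groundStates_iff_localOp {ψ : State Ξ} :
    ψ ∈ groundStates Ξ ↔ ∀ i, localOp Ξ i ψ = ψ := by
  have h0 : ∀ i, ((1 / 2 : ℂ) • (1 - localOp Ξ i)) ψ = 0 ↔ localOp Ξ i ψ = ψ := fun i => by
    rw [LinearMap.smul_apply, smul_eq_zero_iff_right (by norm_num), LinearMap.sub_apply,
      sub_eq_zero, eq_comm]
    rfl
  unfold groundStates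
  rw [LinearMap.mem_ker, hamiltonian_eq]
  refine ⟨fun h i => (h0 i).1 ?_, fun h => ?_⟩
  · refine apply_eq_zero_of_sum_idempotent
      (fun i => isIdempotentElem_half_one_sub (localOp_mul_self Ξ i))
      (fun i j => commute_half_one_sub (localOp_commute Ξ i j)) Finset.univ 0 ψ ?_ i
      (Finset.mem_univ i)
    rw [h, Nat.cast_zero, zero_smul, zero_add]
  · rw [LinearMap.sum_apply]
    exact Finset.sum_eq_zero fun i _ => (h0 i).2 (h i)

/-- The vertex functions generate the functions on the `0`-skeleton. -/
theorem eq_sum_delta (t : C(Ξ.skel₀, ZMod 2)) :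
    ∃ s : Finset (Ξ.Cell 0), t = ∑ v ∈ s, Ξ.delta v := by
  classical
  have hv : ∀ v : Ξ.Cell 0, Ξ.charMap v 0 ∈ Ξ.skel 0 := fun v =>
    Ξ.charMap_mem_skel v (Metric.mem_closedBall_self zero_le_one)
  let pt : Ξ.Cell 0 → Ξ.skel₀ := fun v => ⟨⟨Ξ.charMap v 0, Ξ.skel_mono zero_le_one (hv v)⟩, hv v⟩
  have hpt : ∀ x, ∃ v, x = pt v := by
    intro x
    obtain ⟨m, hm, c, z, -, hz⟩ := Ξ.mem_skel_iff.1 x.2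
    obtain rfl : m = 0 := Nat.le_zero.1 hm
    exact ⟨c, Subtype.ext (Subtype.ext (by rw [← hz, Subsingleton.elim z 0]))⟩
  have hinj : ∀ v w : Ξ.Cell 0, Ξ.charMap v 0 = Ξ.charMap w 0 → v = w := by
    intro v w h
    have hm : ∀ v : Ξ.Cell 0, Ξ.charMap v 0 ∈ Ξ.openCell v := fun v =>
      mem_image_of_mem _ (Metric.mem_ball_self one_pos)
    exact eq_of_heq (Sigma.mk.inj (Ξ.eq_of_mem_openCell (hm v) (h ▸ hm w))).2
  have hδ : ∀ v w, Ξ.delta v (pt w) = if w = v then 1 else 0 := by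
    intro v w
    by_cases h : w = v
    · rw [if_pos h, h]
      exact if_pos rfl
    · rw [if_neg h]
      exact if_neg fun h' => h (hinj _ _ h')
  -- Over `ZMod 2` a function is the sum of the indicators of the points where it is `1`.
  refine ⟨Finset.univ.filter fun v => t (pt v) = 1, ContinuousMap.ext fun x => ?_⟩
  obtain ⟨w, rfl⟩ := hpt x
  rw [ContinuousMap.sum_apply]
  simp only [hδ, Finset.sum_ite_eq, Finset.mem_filter, Finset.mem_univ, true_and]
  have hz : ∀ a : ZMod 2, a = if a = 1 then 1 else 0 := by decide
  exact hz _

/-- The ground states are the functions on the classes of bundles with trivial holonomy around the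
`2`-cells which do not depend on the trivialization over the vertices. -/
theorem mem_groundStates_iff {ψ : State Ξ} : ψ ∈ groundStates Ξ ↔
    (∀ (t : C(Ξ.skel₀, ZMod 2)) (E : Field Ξ), ψ (E.shift t) = ψ E) ∧
      ∀ (E : Field Ξ) (f : Ξ.Cell 2), E.holonomy (Ξ.attach f) ≠ 0 → ψ E = 0 := by
  have hz : ∀ a : ZMod 2, a ≠ 0 → a = 1 := by decide
  rw [mem_groundStates_iff_localOp]
  constructor
  · intro h
    refine ⟨fun t => ?_, fun E f hf => ?_⟩
    · obtain ⟨s, rfl⟩ := eq_sum_delta Ξ t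
      classical
      induction s using Finset.induction_on with
      | empty =>
        intro E
        rw [Finset.sum_empty, RelBunClass.shift_zero]
      | insert v s hv ih =>
        intro E
        rw [Finset.sum_insert hv, ← RelBunClass.shift_shift, ← ih E]
        exact congr_fun (h (Sum.inl v)) _
    · have h1 : (-1 : ℂ) ^ (E.holonomy (Ξ.attach f)).val * ψ E = ψ E :=
        congr_fun (h (Sum.inr f)) E
      rw [hz _ hf, ZMod.val_one, pow_one, neg_one_mul] at h1
      exact self_eq_neg.1 h1.symm
  · rintro ⟨h1, h2⟩ (v | f)
    · exact funext fun E => h1 _ E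
    · refine funext fun E => ?_
      change (-1 : ℂ) ^ (E.holonomy (Ξ.attach f)).val * ψ E = ψ E
      by_cases h0 : E.holonomy (Ξ.attach f) = 0
      · rw [h0, ZMod.val_zero, pow_zero, one_mul]
      · rw [h2 E f h0, mul_zero]

end ToricCode

/-! ### The comparison of ground states and functions on bundles -/

namespace ToricCode

open CWStructure

variable {M : Type u} [TopologicalSpace M] [T2Space M] (Ξ : CWStructure M)

theorem toBunClass_fieldOfBundle (E : RelBundle M (Ξ.skel 0)) :
    (fieldOfBundle Ξ E).toBunClass = (BunClass.mk E.bundle).pullback (Ξ.skelVal 1) := rfl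

theorem holonomy_eq_zero_of_toBunClass {F : Field Ξ} {Q : BunClass M}
    (h : F.toBunClass = Q.pullback (Ξ.skelVal 1)) (f : Ξ.Cell 2) :
    F.holonomy (Ξ.attach f) = 0 := by
  obtain ⟨F, rfl⟩ := F.exists_rep
  obtain ⟨Q, rfl⟩ := Q.exists_rep
  obtain ⟨φ⟩ := BunClass.mk_eq_mk.1 h
  exact (PrincipalBundle.holonomy_congr φ _).trans (Ξ.holonomy_attach_of_pullback Q f)

/-- The inclusion of `1`-skeleta induced by a refinement. -/
def refineIncl {Ξ Ξ' : CWStructure M} (h : Ξ.Refines Ξ') : C(Ξ.skel 1, Ξ'.skel 1) :=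
  ⟨fun x => ⟨x.1, h.skel_subset 1 x.2⟩, continuous_subtype_val.subtype_mk _⟩

theorem toBunClass_restrictField_eq {Ξ Ξ' : CWStructure M} (h : Ξ.Refines Ξ') (F : Field Ξ') :
    (restrictField h F).toBunClass = F.toBunClass.pullback (refineIncl h) :=
  RelBunClass.toBunClass_pullback _ _ F

theorem toBunClass_restrictField {Ξ Ξ' : CWStructure M} (h : Ξ.Refines Ξ') {F : Field Ξ'}
    {Q : BunClass M} (hF : F.toBunClass = Q.pullback (Ξ'.skelVal 1)) :
    (restrictField h F).toBunClass = Q.pullback (Ξ.skelVal 1) := by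
  rw [toBunClass_restrictField_eq, hF, BunClass.pullback_pullback]
  rfl

/-- The map of `1`-skeleta induced by a homeomorphism. -/
def homeoSkel (f : M ≃ₜ M) : C(Ξ.skel 1, (Ξ.image f).skel 1) :=
  ⟨fun x => ⟨f x.1, Ξ.map_mem_skel_image f x.2⟩,
    (f.continuous.comp continuous_subtype_val).subtype_mk _⟩

/-- The pullback of fields along a homeomorphism. -/
def homeoField (f : M ≃ₜ M) : Field (Ξ.image f) → Field Ξ :=
  RelBunClass.pullback (homeoSkel Ξ f) fun _ hx => Ξ.map_mem_skel_image f hx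

theorem homeoPush_apply (f : M ≃ₜ M) (ψ : State Ξ) (E : Field (Ξ.image f)) :
    homeoPush Ξ f ψ E = ψ (homeoField Ξ f E) := rfl

theorem toBunClass_homeoField (f : M ≃ₜ M) (E : Field (Ξ.image f)) :
    (homeoField Ξ f E).toBunClass = E.toBunClass.pullback (homeoSkel Ξ f) :=
  RelBunClass.toBunClass_pullback _ _ E

theorem holonomy_homeoField (f : M ≃ₜ M) (E : Field (Ξ.image f)) (c : Ξ.Cell 2) :
    (homeoField Ξ f E).holonomy (Ξ.attach c) = E.holonomy ((Ξ.image f).attach c) :=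
  RelBunClass.holonomy_pullback _ _ _ E

theorem holProj_apply_of_flat (ψ : State Ξ) {E : Field Ξ}
    (h : ∀ f, E.holonomy (Ξ.attach f) = 0) : holProj Ξ ψ E = ψ E := by
  unfold holProj
  rw [LinearMap.mulLeft_apply, Pi.mul_apply, if_pos h, one_mul]

theorem holProj_apply_of_not_flat (ψ : State Ξ) {E : Field Ξ}
    (h : ¬∀ f, E.holonomy (Ξ.attach f) = 0) : holProj Ξ ψ E = 0 := by
  unfold holProj
  rw [LinearMap.mulLeft_apply, Pi.mul_apply, if_neg h, zero_mul]

variable [CompactSpace M]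

/-- Every bundle on `M` can be trivialized over the vertices. -/
theorem exists_relBundle (Q : BunClass M) :
    ∃ E : RelBundle M (Ξ.skel 0), BunClass.mk E.bundle = Q := by
  obtain ⟨P, rfl⟩ := Q.exists_rep
  have : Finite (Ξ.skel 0) := Finite.of_injective
    (fun x => (⟨⟨x, Ξ.skel_mono zero_le_one x.2⟩, x.2⟩ : Ξ.skel₀)) fun x y h =>
      Subtype.ext (congrArg (fun z : Ξ.skel₀ => (z.1 : M)) h)
  choose s hs using P.proj_surjective
  exact ⟨⟨P, ⟨fun a => s a, continuous_of_discreteTopology⟩, fun a => hs a⟩, rfl⟩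

/-- The restriction of a bundle on `M`, with some trivialization over the vertices. -/
noncomputable def fieldOfClass (Q : BunClass M) : Field Ξ :=
  fieldOfBundle Ξ (exists_relBundle Ξ Q).choose

theorem toBunClass_fieldOfClass (Q : BunClass M) :
    (fieldOfClass Ξ Q).toBunClass = Q.pullback (Ξ.skelVal 1) := by
  unfold fieldOfClass
  rw [toBunClass_fieldOfBundle, (exists_relBundle Ξ Q).choose_spec]

/-- Two fields with isomorphic bundles differ by a shift of the trivialization, which a ground state
does not see. -/
theorem eq_of_toBunClass_eq {ψ : State Ξ} (hψ : ψ ∈ groundStates Ξ) {E F : Field Ξ}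
    (h : E.toBunClass = F.toBunClass) : ψ E = ψ F := by
  obtain ⟨t, rfl⟩ := RelBunClass.exists_shift_eq h
  exact (((mem_groundStates_iff Ξ).1 hψ).1 t E).symm

/-- Evaluation of a ground state on the bundles on `M`. -/
noncomputable def groundMap : groundStates Ξ →ₗ[ℂ] DW₀ M :=
  LinearMap.funLeft ℂ ℂ (fieldOfClass Ξ) ∘ₗ (groundStates Ξ).subtype

/-- The trivialization chosen in `fieldOfClass` does not matter: any field restricted from `Q`
computes the value. -/
theorem groundMap_apply (ψ : groundStates Ξ) {Q : BunClass M} {F : Field Ξ}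
    (h : F.toBunClass = Q.pullback (Ξ.skelVal 1)) : groundMap Ξ ψ Q = ψ.1 F :=
  eq_of_toBunClass_eq Ξ ψ.2 ((toBunClass_fieldOfClass Ξ Q).trans h.symm)

theorem exists_class_of_field {F : Field Ξ} (h : ∀ f, F.holonomy (Ξ.attach f) = 0) :
    ∃ Q : BunClass M, F.toBunClass = Q.pullback (Ξ.skelVal 1) := by
  obtain ⟨F, rfl⟩ := F.exists_rep
  obtain ⟨Q, hQ⟩ := Ξ.exists_extension F.bundle h
  exact ⟨Q, hQ.symm⟩

/-- A field is either flat, hence restricted from `M`, or has holonomy, where ground states vanish;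
this gives injectivity. Conversely a function on `π₀ Bun(M)` is extended by zero to fields that do
not come from `M`, and is well defined because the 1-skeleton determines the bundle. -/
theorem groundMap_bijective : Function.Bijective (groundMap Ξ) := by
  classical
  constructor
  · rw [← LinearMap.ker_eq_bot, LinearMap.ker_eq_bot']
    intro ψ hψ
    refine Subtype.ext (funext fun F => ?_)
    by_cases hF : ∀ f, F.holonomy (Ξ.attach f) = 0
    · obtain ⟨Q, hQ⟩ := exists_class_of_field Ξ hF
      rw [← groundMap_apply Ξ ψ hQ, hψ]
      rfl
    · obtain ⟨f, hf⟩ := not_forall.1 hF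
      exact ((mem_groundStates_iff Ξ).1 ψ.2).2 F f hf
  · intro Ψ
    let ψ : State Ξ := fun F =>
      if h : ∃ Q : BunClass M, F.toBunClass = Q.pullback (Ξ.skelVal 1) then Ψ h.choose else 0
    have hψ : ψ ∈ groundStates Ξ := by
      refine (mem_groundStates_iff Ξ).2 ⟨fun t E => ?_, fun E f hf => dif_neg ?_⟩
      · simp only [ψ, RelBunClass.toBunClass_shift]
      · rintro ⟨Q, hQ⟩
        exact hf (holonomy_eq_zero_of_toBunClass Ξ hQ f)
    refine ⟨⟨ψ, hψ⟩, funext fun Q => ?_⟩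
    have hQ := toBunClass_fieldOfClass Ξ Q
    have hex : ∃ R : BunClass M, (fieldOfClass Ξ Q).toBunClass = R.pullback (Ξ.skelVal 1) :=
      ⟨Q, hQ⟩
    have hQR : hex.choose = Q :=
      Ξ.pullback_skelVal_injective (hex.choose_spec.symm.trans hQ)
    exact (dif_pos hex).trans (congrArg Ψ hQR)

/-- The identification of the ground states with the functions on `π₀ Bun(M)`. -/
noncomputable def groundEquiv : groundStates Ξ ≃ₗ[ℂ] DW₀ M :=
  LinearEquiv.ofBijective (groundMap Ξ) (groundMap_bijective Ξ)

theorem groundEquiv_apply (ψ : groundStates Ξ) {Q : BunClass M} {F : Field Ξ}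
    (h : F.toBunClass = Q.pullback (Ξ.skelVal 1)) : groundEquiv Ξ ψ Q = ψ.1 F :=
  groundMap_apply Ξ ψ h

variable {Ξ} in
-- The pushed state is gauge invariant but may be nonzero where holonomies cancel between the pieces
-- of a subdivided face; `holProj` removes such fields.
theorem holProj_refinePush_mem {Ξ' : CWStructure M} (h : Ξ.Refines Ξ') (ψ : groundStates Ξ) :
    holProj Ξ' (refinePush h ψ.1) ∈ groundStates Ξ' := by
  refine (mem_groundStates_iff Ξ').2 ⟨fun t E => ?_, fun E f hf =>
    holProj_apply_of_not_flat Ξ' _ fun h' => hf (h' f)⟩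
  by_cases hE : ∀ f, E.holonomy (Ξ'.attach f) = 0
  · rw [holProj_apply_of_flat Ξ' _ hE,
      holProj_apply_of_flat Ξ' _ fun f => (holonomy_shift Ξ' t f E).trans (hE f)]
    refine eq_of_toBunClass_eq Ξ ψ.2 ?_
    rw [toBunClass_restrictField_eq, toBunClass_restrictField_eq, RelBunClass.toBunClass_shift]
  · rw [holProj_apply_of_not_flat Ξ' _ hE,
      holProj_apply_of_not_flat Ξ' _ fun h' => hE fun f =>
        (holonomy_shift Ξ' t f E).symm.trans (h' f)]

variable {Ξ} in
-- On fields coming from `M` the projection does nothing, and restricting through the finer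
-- 1-skeleton agrees with restricting directly.
theorem groundEquiv_refine {Ξ' : CWStructure M} (h : Ξ.Refines Ξ') (ψ : groundStates Ξ) :
    groundEquiv Ξ' ⟨_, holProj_refinePush_mem h ψ⟩ = groundEquiv Ξ ψ := by
  funext Q
  have hQ := toBunClass_fieldOfClass Ξ' Q
  rw [groundEquiv_apply Ξ' _ hQ, groundEquiv_apply Ξ ψ (toBunClass_restrictField h hQ)]
  exact holProj_apply_of_flat Ξ' _ (holonomy_eq_zero_of_toBunClass Ξ' hQ)

theorem homeoPush_mem (f : M ≃ₜ M) (ψ : groundStates Ξ) :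
    homeoPush Ξ f ψ.1 ∈ groundStates (Ξ.image f) := by
  refine (mem_groundStates_iff _).2 ⟨fun t E => ?_, fun E c hc => ?_⟩
  · rw [homeoPush_apply, homeoPush_apply]
    refine eq_of_toBunClass_eq Ξ ψ.2 ?_
    rw [toBunClass_homeoField, toBunClass_homeoField, RelBunClass.toBunClass_shift]
  · exact ((mem_groundStates_iff Ξ).1 ψ.2).2 (homeoField Ξ f E) c
      ((holonomy_homeoField Ξ f E c).trans_ne hc)

theorem groundEquiv_homeoPush (f : M ≃ₜ M) (ψ : groundStates Ξ) (Q : BunClass M) :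
    groundEquiv (Ξ.image f) ⟨_, homeoPush_mem Ξ f ψ⟩ Q =
      groundEquiv Ξ ψ (Q.pullback ⟨f, f.continuous⟩) := by
  have hQ := toBunClass_fieldOfClass (Ξ.image f) Q
  rw [groundEquiv_apply (Ξ.image f) _ hQ]
  refine (homeoPush_apply Ξ f ψ.1 _).trans (groundEquiv_apply Ξ ψ ?_).symm
  rw [toBunClass_homeoField, hQ, BunClass.pullback_pullback, BunClass.pullback_pullback]
  rfl

/-! ### The colimit -/

section Colimit

variable (𝓛 : Set (CWStructure M))

open scoped Classical in
/-- The map from the direct sum induced by the identifications with `DW₀ M`. -/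
noncomputable def groundSumMap : GroundSum 𝓛 →ₗ[ℂ] DW₀ M :=
  DirectSum.toModule ℂ 𝓛 (DW₀ M) fun Ξ => (groundEquiv Ξ.1).toLinearMap

theorem groundSumMap_toSum (Ξ : 𝓛) (ψ : groundStates Ξ.1) :
    groundSumMap 𝓛 (toSum 𝓛 Ξ ψ) = groundEquiv Ξ.1 ψ := by
  classical
  exact DirectSum.toModule_lof (M := fun Ξ : 𝓛 => groundStates Ξ.1) ℂ Ξ ψ

theorem colimitRelations_le_ker : colimitRelations 𝓛 ≤ LinearMap.ker (groundSumMap 𝓛) := by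
  refine Submodule.span_le.2 ?_
  rintro _ ⟨Ξ, Ξ', h, x, y, hy, rfl⟩
  obtain rfl : y = ⟨_, holProj_refinePush_mem h x⟩ := Subtype.ext hy
  rw [SetLike.mem_coe, LinearMap.mem_ker, map_sub, groundSumMap_toSum, groundSumMap_toSum,
    groundEquiv_refine, sub_self]

/-- The map from the colimit induced by the identifications with `DW₀ M`. -/
noncomputable def colimitMap : ColimitGround 𝓛 →ₗ[ℂ] DW₀ M :=
  (colimitRelations 𝓛).liftQ (groundSumMap 𝓛) (colimitRelations_le_ker 𝓛)

theorem colimitMap_toColimit (Ξ : 𝓛) (ψ : groundStates Ξ.1) :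
    colimitMap 𝓛 (toColimit 𝓛 Ξ ψ) = groundEquiv Ξ.1 ψ :=
  groundSumMap_toSum 𝓛 Ξ ψ

variable {𝓛}

/-- Followed by `colimitMap`, the canonical map is the isomorphism `groundEquiv`. -/
theorem toColimit_injective (Ξ : 𝓛) : Function.Injective (toColimit 𝓛 Ξ) := by
  intro x y h
  refine (groundEquiv Ξ.1).injective ?_
  rw [← colimitMap_toColimit, h, colimitMap_toColimit]

/-- A refinement carries the ground state representing `Ψ` to the one representing `Ψ`. Phrased
through `Ψ`, the claim is symmetric and transitive in the CW structures, so it passes from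
refinements to zigzags. -/
theorem toColimit_symm_eq (h𝓛 : RefinementConnected 𝓛) (Ξ Ξ' : 𝓛) (Ψ : DW₀ M) :
    toColimit 𝓛 Ξ ((groundEquiv Ξ.1).symm Ψ) = toColimit 𝓛 Ξ' ((groundEquiv Ξ'.1).symm Ψ) := by
  induction h𝓛 Ξ Ξ' with
  | rel Θ Θ' h =>
    set x := (groundEquiv Θ.1).symm Ψ
    have hx : groundEquiv Θ.1 x = Ψ := LinearEquiv.apply_symm_apply _ _
    have hy : (groundEquiv Θ'.1).symm Ψ = ⟨_, holProj_refinePush_mem h x⟩ := by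
      rw [LinearEquiv.symm_apply_eq, groundEquiv_refine, hx]
    rw [hy]
    refine (Submodule.Quotient.eq _).2 (Submodule.subset_span ?_)
    exact ⟨Θ, Θ', h, x, _, rfl, rfl⟩
  | refl Θ => rfl
  | symm Θ Θ' _ ih => exact ih.symm
  | trans Θ Θ' Θ'' _ _ ih ih' => exact ih.trans ih'

/-- The colimit is generated by the images of all summands, and each element of a summand is
represented on `Ξ` by `toColimit_symm_eq`. -/
theorem toColimit_surjective (h𝓛 : RefinementConnected 𝓛) (Ξ : 𝓛) :
    Function.Surjective (toColimit 𝓛 Ξ) := by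
  classical
  rw [← LinearMap.range_eq_top, eq_top_iff]
  rintro z -
  obtain ⟨z, rfl⟩ := Submodule.Quotient.mk_surjective _ z
  have key : LinearMap.range ((colimitRelations 𝓛).mkQ) ≤ LinearMap.range (toColimit 𝓛 Ξ) := by
    rintro _ ⟨z, rfl⟩
    induction z using DirectSum.induction_on with
    | zero => exact Submodule.zero_mem _
    | of Θ ψ =>
      refine ⟨(groundEquiv Ξ.1).symm (groundEquiv Θ.1 ψ), ?_⟩
      rw [toColimit_symm_eq h𝓛 Ξ Θ, LinearEquiv.symm_apply_apply]
      rfl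
    | add x y hx hy => exact Submodule.add_mem _ hx hy
  exact key ⟨z, rfl⟩

theorem colimitMap_bijective (hne : 𝓛.Nonempty) (h𝓛 : RefinementConnected 𝓛) :
    Function.Bijective (colimitMap 𝓛) := by
  obtain ⟨Ξ, hΞ⟩ := hne
  have hc : colimitMap 𝓛 ∘ toColimit 𝓛 ⟨Ξ, hΞ⟩ = groundEquiv Ξ :=
    funext (colimitMap_toColimit 𝓛 ⟨Ξ, hΞ⟩)
  refine (Function.Bijective.of_comp_iff (colimitMap 𝓛)
    ⟨toColimit_injective _, toColimit_surjective h𝓛 ⟨Ξ, hΞ⟩⟩).1 ?_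
  rw [hc]
  exact (groundEquiv Ξ).bijective

/-- The identification of the colimit with `DW₀ M`. -/
noncomputable def colimitEquiv (hne : 𝓛.Nonempty) (h𝓛 : RefinementConnected 𝓛) :
    ColimitGround 𝓛 ≃ₗ[ℂ] DW₀ M :=
  LinearEquiv.ofBijective (colimitMap 𝓛) (colimitMap_bijective hne h𝓛)

end Colimit

end ToricCode

/-! ### Transport of representations and the main theorem. -/

/-- Transport of a representation along a linear isomorphism. -/
def Representation.conjEquiv {k G V W : Type*} [CommSemiring k] [Monoid G] [AddCommMonoid V]
    [AddCommMonoid W] [Module k V] [Module k W] (ρ : Representation k G W) (e : V ≃ₗ[k] W) :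
    Representation k G V where
  toFun g := e.symm.toLinearMap ∘ₗ ρ g ∘ₗ e.toLinearMap
  map_one' := LinearMap.ext fun v => by simp
  map_mul' g h := LinearMap.ext fun v => by simp

theorem Representation.conjEquiv_apply {k G V W : Type*} [CommSemiring k] [Monoid G]
    [AddCommMonoid V] [AddCommMonoid W] [Module k V] [Module k W] (ρ : Representation k G W)
    (e : V ≃ₗ[k] W) (g : G) (v : V) : e (ρ.conjEquiv e g v) = ρ g (e v) :=
  e.apply_symm_apply _

theorem mainTheorem11 (d : ℕ) (M : Type u) [TopologicalSpace M] [T2Space M] [CompactSpace M]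
    [ChartedSpace (EuclideanSpace ℝ (Fin d)) M] [IsManifold (𝓡 d) ∞ M] :
    ∃ (ρDW : Representation ℂ (MCG d M) (DW₀ M))
      (Φ : ∀ Ξ : CWStructure M, ToricCode.groundStates Ξ ≃ₗ[ℂ] DW₀ M),
      -- the mapping class group action on `DW₀ M` is given by the mapping cylinders,
      -- and it is induced from the standard action on isomorphism classes of bundles
      (∀ (f : Diff d M) (Ψ : DW₀ M),
        ρDW (f : MCG d M) Ψ = DW₀.mappingCylinder f.toHomeomorph Ψ) ∧
      (∀ (f : Diff d M) (Ψ : DW₀ M) (Q : BunClass M),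
        ρDW (f : MCG d M) Ψ Q = Ψ (Q.pullback ⟨f, f.continuous⟩)) ∧
      -- the identification of the ground states with `DW₀ M`
      (∀ (Ξ : CWStructure M) (ψ : ToricCode.groundStates Ξ) (E : RelBundle M (Ξ.skel 0)),
        Φ Ξ ψ (BunClass.mk E.bundle) = ψ.1 (ToricCode.fieldOfBundle Ξ E)) ∧
      -- it is compatible with refinements
      (∀ (Ξ Ξ' : CWStructure M) (h : Ξ.Refines Ξ') (ψ : ToricCode.groundStates Ξ),
        ∃ ψ' : ToricCode.groundStates Ξ',
          ψ'.1 = ToricCode.holProj Ξ' (ToricCode.refinePush h ψ.1) ∧ Φ Ξ' ψ' = Φ Ξ ψ) ∧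
      -- it intertwines the transport of structure along a diffeomorphism with the action on `DW₀ M`
      (∀ (f : Diff d M) (Ξ : CWStructure M) (ψ : ToricCode.groundStates Ξ),
        ∃ ψ' : ToricCode.groundStates (Ξ.image f.toHomeomorph),
          ψ'.1 = ToricCode.homeoPush Ξ f.toHomeomorph ψ.1 ∧
          Φ (Ξ.image f.toHomeomorph) ψ' = ρDW (f : MCG d M) (Φ Ξ ψ)) ∧
      -- for a class of CW structures on which the colimit over refinements is meaningful, the
      -- mapping class group acts on the colimit, which is equivariantly identified with `DW₀ M`
      (∀ 𝓛 : Set (CWStructure M), 𝓛.Nonempty →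
        ∀ h𝓛 : ∀ (f : Diff d M), ∀ Ξ ∈ 𝓛, Ξ.image f.toHomeomorph ∈ 𝓛,
        ToricCode.RefinementConnected 𝓛 →
        (∀ Ξ : 𝓛, Function.Bijective (ToricCode.toColimit 𝓛 Ξ)) ∧
        ∃ (ρ : Representation ℂ (MCG d M) (ToricCode.ColimitGround 𝓛))
          (Θ : ToricCode.ColimitGround 𝓛 ≃ₗ[ℂ] DW₀ M),
          (∀ (f : Diff d M) (Ξ : 𝓛) (ψ : ToricCode.groundStates Ξ.1)
            (ψ' : ToricCode.groundStates (Ξ.1.image f.toHomeomorph)),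
            ψ'.1 = ToricCode.homeoPush Ξ.1 f.toHomeomorph ψ.1 →
            ρ (f : MCG d M) (ToricCode.toColimit 𝓛 Ξ ψ) =
              ToricCode.toColimit 𝓛 ⟨_, h𝓛 f Ξ.1 Ξ.2⟩ ψ') ∧
          (∀ (Ξ : 𝓛) (ψ : ToricCode.groundStates Ξ.1),
            Θ (ToricCode.toColimit 𝓛 Ξ ψ) = Φ Ξ.1 ψ) ∧
          ∀ (g : MCG d M) (z : ToricCode.ColimitGround 𝓛), Θ (ρ g z) = ρDW g (Θ z)) := by
  -- Needed for the finiteness of automorphism groups in the mapping cylinder formula.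
  have : LocallyConnectedSpace M :=
    ChartedSpace.locallyConnectedSpace (EuclideanSpace ℝ (Fin d)) M
  have hpush : ∀ (f : Diff d M) (Ξ : CWStructure M) (ψ : ToricCode.groundStates Ξ),
      ToricCode.groundEquiv (Ξ.image f.toHomeomorph)
        ⟨_, ToricCode.homeoPush_mem Ξ f.toHomeomorph ψ⟩ =
      mcgRepresentation d M (f : MCG d M) (ToricCode.groundEquiv Ξ ψ) := fun f Ξ ψ =>
    funext fun Q => ToricCode.groundEquiv_homeoPush Ξ f.toHomeomorph ψ Q
  refine ⟨mcgRepresentation d M, fun Ξ => ToricCode.groundEquiv Ξ, fun f Ψ => funext fun Q => ?_,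
    fun f Ψ Q => rfl, fun Ξ ψ E => ?_, fun Ξ Ξ' h ψ => ?_, fun f Ξ ψ => ?_,
    fun 𝓛 hne h𝓛 hconn => ⟨fun Ξ => ?_, ?_⟩⟩
  · exact (DW₀.mappingCylinder_apply f.toHomeomorph Ψ Q).symm
  · exact ToricCode.groundEquiv_apply Ξ ψ (ToricCode.toBunClass_fieldOfBundle Ξ E)
  · exact ⟨_, rfl, ToricCode.groundEquiv_refine h ψ⟩
  · exact ⟨_, rfl, hpush f Ξ ψ⟩
  · exact ⟨ToricCode.toColimit_injective Ξ, ToricCode.toColimit_surjective hconn Ξ⟩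
  · let Θ := ToricCode.colimitEquiv hne hconn
    -- Transporting the action from `DW₀ M` makes it factor through the mapping class group at once;
    -- its formula on `c_Ξ` is then checked after applying `Θ`.
    refine ⟨(mcgRepresentation d M).conjEquiv Θ, Θ, fun f Ξ ψ ψ' hψ' => ?_,
      ToricCode.colimitMap_toColimit 𝓛, fun g z => Representation.conjEquiv_apply _ Θ g z⟩
    obtain rfl : ψ' = ⟨_, ToricCode.homeoPush_mem Ξ.1 f.toHomeomorph ψ⟩ := Subtype.ext hψ'
    refine Θ.injective ?_
    rw [Representation.conjEquiv_apply]
    have h1 : Θ (ToricCode.toColimit 𝓛 Ξ ψ) = ToricCode.groundEquiv Ξ.1 ψ :=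
      ToricCode.colimitMap_toColimit 𝓛 Ξ ψ
    rw [h1, ← hpush]
    exact (ToricCode.colimitMap_toColimit 𝓛 ⟨_, h𝓛 f Ξ.1 Ξ.2⟩ _).symm
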